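/- Let $\mathbb{O}\cong\mathbb{R}^8$ be the algebra of octonions with standard basis $e_0=1,e_1,\dots,e_7$, i.e. $e_ie_j=-\delta_{ij}+\sum_k\epsilon_{ijk}e_k$ for $i,j\ge 1$, where $\epsilon$ is totally antisymmetric and equals $1$ on $(1,2,3),(1,4,5),(2,4,6),(3,4,7),(5,3,6),(6,1,7),(7,2,5)$ (and is $0$ off the permutations of these triples). Fix $p\in\{0,1,\dots,6\}$, put $q=7-p$, and split $\mathbb{O}=\mathbb{R}^{p+1}\oplus\mathbb{R}^{q}$ with $\mathbb{R}^{p+1}=\mathrm{span}(e_0,\dots,e_p)$ and $\mathbb{R}^q=\mathrm{span}(e_{p+1},\dots,e_7)$. Let $\mathbb{S}$ be the unit sphere of $\mathbb{R}^q$, and let $D_{x_p}=\sum_{i=0}^p e_i\partial_{x_i}$ and $\overline{D}_{x_p}=\partial_{x_0}-\sum_{i=1}^p e_i\partial_{x_i}$. Let $D\subseteq\mathbb{R}^{p+2}=\mathbb{R}^{p+1}\times\mathbb{R}$ be an open set that is invariant under $(x_p,r)\mapsto(x_p,-r)$, and let $$\Omega=\Omega_D=\{x_p+r\omega:\ \omega\in\mathbb{S},\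 r\ge 0,\ (x_p,r)\in D\}\subseteq\mathbb{O}.$$ Assume that $\Omega$ is a $p$-symmetric domain: it is non-empty, open and connected, and if $x_p+r\omega\in\Omega$ with $x_p\in\mathbb{R}^{p+1}$, $r>0$, $\omega\in\mathbb{S}$, then $x_p+r\omega'\in\Omega$ for all $\omega'\in\mathbb{S}$. Let $\mathcal{GSM}(\Omega)$ be the set of (left) generalized partial-slice monogenic functions of type $p$: the functions $f:\Omega\to\mathbb{O}$ such that for every $\omega\in\mathbb{S}$ the restriction $f_\omega(x_p,r)=f(x_p+r\omega)$ is of class $C^1$ on the open set $\Omega_\omega=\{(x_p,r)\in\mathbb{R}^{p+2}: x_p+r\omega\in\Omega\}$ and satisfies $D_{x_p}f_\omega+\omega\,\partial_r f_\omega=0$ there. Let $\mathcal{GSR}(\Omega_D)$ be the set of generalized partial-slice regular functions of type $p$: the functions $f:\Omega_D\to\mathbb{O}$ of the form $f(x_p+r\omega)=F_1(x_p,r)+\omega F_2(x_p,r)$ (for $\omega\in\mathbb{S}$, $r\ge0$, $(x_p,r)\in D$), where $F=(F_1,F_2):D\to\mathbb{O}^2$ is of class $C^1$, $F_1$ is even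 and $F_2$ is odd in $r$ ($F$ is a stem function), and $$D_{x_p}F_1-\partial_rF_2=0,\qquad \overline{D}_{x_p}F_2+\partial_rF_1=0\qquad\text{on } D.$$ Then: (i) if $\Omega\cap\mathbb{R}^{p+1}=\emptyset$, then $\mathcal{GSM}(\Omega)\supsetneqq\mathcal{GSR}(\Omega_D)$; (ii) if $\Omega\cap\mathbb{R}^{p+1}\ne\emptyset$, then $\mathcal{GSM}(\Omega)=\mathcal{GSR}(\Omega_D)$. -/

import Mathlib

noncomputable section

namespace OctSlice

/-! ### The algebra of octonions -/

/-- The octonions, as the Euclidean space `ℝ⁸` with basis `e₀ = 1, e₁, …, e₇`;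
the multiplication is defined below. -/
abbrev Octonion : Type := EuclideanSpace ℝ (Fin 8)

/-- The seven oriented triples that define the multiplication. -/
def triples : List (Fin 8 × Fin 8 × Fin 8) :=
  [(1, 2, 3), (1, 4, 5), (2, 4, 6), (3, 4, 7), (5, 3, 6), (6, 1, 7), (7, 2, 5)]

/-- The symbol `ε i j k`: the sign of the permutation that takes one of the triples
to `(i, j, k)`, and `0` if there is none. -/
def epsilon (i j k : Fin 8) : ℤ :=
  if (i, j, k) ∈ triples ∨ (j, k, i) ∈ triples ∨ (k, i, j) ∈ triples then 1
  else if (j, i, k) ∈ triples ∨ (i, k, j) ∈ triples ∨ (k, j, i) ∈ triples then -1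
  else 0

/-- The coefficient of `e_k` in the product `e_i e_j`: `e₀` is the unit, and
`e_i e_j = -δ_{ij} + ∑ k, ε_{ijk} e_k` for `i, j ≥ 1`. -/
def structConst (i j k : Fin 8) : ℤ :=
  if i = 0 then (if j = k then 1 else 0)
  else if j = 0 then (if i = k then 1 else 0)
  else if k = 0 then (if i = j then -1 else 0)
  else epsilon i j k

/-- Octonionic multiplication (bilinear, non-commutative, non-associative). -/
instance : Mul Octonion where
  mul x y := WithLp.toLp 2 fun k => ∑ i, ∑ j, (structConst i j k : ℝ) * x i * y j

/-- Octonionic conjugation. -/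
def conj (x : Octonion) : Octonion :=
  WithLp.toLp 2 fun i => if i = 0 then x 0 else -x i

/-! ### The splitting `𝕆 = ℝ^{p+1} ⊕ ℝ^q`, `q = 7 - p` -/

/-- The space `ℝ^{p+2} = ℝ^{p+1} × ℝ` of the variables `(x_p, r)`. -/
abbrev Para (p : ℕ) : Type := EuclideanSpace ℝ (Fin (p + 1)) × ℝ

/-- The inclusion `ℝ^{p+1} → 𝕆`, `(x₀, …, x_p) ↦ x₀ + x₁ e₁ + ⋯ + x_p e_p` (for `p ≤ 6`). -/
def incl (p : ℕ) (x : EuclideanSpace ℝ (Fin (p + 1))) : Octonion :=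
  WithLp.toLp 2 fun i => if h : i.val < p + 1 then x ⟨i.val, h⟩ else 0

/-- The copy of `ℝ^{p+1}` in `𝕆`. -/
def realPart (p : ℕ) : Set Octonion := Set.range (incl p)

/-- The component `x_p ∈ ℝ^{p+1}` of `x = x_p + x_q` (for `p ≤ 6`). -/
def projP (p : ℕ) (x : Octonion) : EuclideanSpace ℝ (Fin (p + 1)) :=
  WithLp.toLp 2 fun i => if h : i.val < 8 then x ⟨i.val, h⟩ else 0

/-- The component `x_q ∈ ℝ^q` of `x = x_p + x_q`. -/
def projQ (p : ℕ) (x : Octonion) : Octonion :=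
  WithLp.toLp 2 fun i => if i.val < p + 1 then 0 else x i

/-- The unit sphere `𝕊` of `ℝ^q = span(e_{p+1}, …, e_7)`. -/
def sphereQ (p : ℕ) : Set Octonion :=
  {w | (∀ i : Fin 8, i.val ≤ p → w i = 0) ∧ ‖w‖ = 1}

/-- The point `x_p + r ω` of `𝕆`. -/
def slicePt (p : ℕ) (w : Octonion) (z : Para p) : Octonion := incl p z.1 + z.2 • w

/-- `Ω` is partially symmetric with respect to `ℝ^{p+1}`. -/
def IsPSymmetric (p : ℕ) (U : Set Octonion) : Prop :=
  ∀ (x : EuclideanSpace ℝ (Fin (p + 1))) (r : ℝ), 0 < r → ∀ w ∈ sphereQ p,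
    slicePt p w (x, r) ∈ U → ∀ w' ∈ sphereQ p, slicePt p w' (x, r) ∈ U

/-! ### Differential operators in the variables `(x_p, r)` -/

/-- The partial derivative `∂g/∂x_i`, `0 ≤ i ≤ p`. -/
def dx {p : ℕ} (i : Fin (p + 1)) (g : Para p → Octonion) (z : Para p) : Octonion :=
  fderiv ℝ g z (EuclideanSpace.single i 1, 0)

/-- The partial derivative `∂g/∂r`. -/
def dr {p : ℕ} (g : Para p → Octonion) (z : Para p) : Octonion := fderiv ℝ g z (0, 1)

/-- The unit `e_i`, `0 ≤ i ≤ p`. -/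
def unitP {p : ℕ} (i : Fin (p + 1)) : Octonion := incl p (EuclideanSpace.single i 1)

/-- The operator `D_{x_p} = ∑_{i=0}^p e_i ∂_{x_i}`. -/
def DP {p : ℕ} (g : Para p → Octonion) (z : Para p) : Octonion :=
  ∑ i : Fin (p + 1), unitP i * dx i g z

/-- The conjugate operator `∂_{x_0} - ∑_{i=1}^p e_i ∂_{x_i}`. -/
def DPbar {p : ℕ} (g : Para p → Octonion) (z : Para p) : Octonion :=
  ∑ i : Fin (p + 1), conj (unitP i) * dx i g z

/-! ### Generalized partial-slice monogenic functions -/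

/-- The slice `Ω_ω = Ω ∩ (ℝ^{p+1} ⊕ ω ℝ)`, as a subset of `ℝ^{p+2}`. -/
def sliceSet (p : ℕ) (U : Set Octonion) (w : Octonion) : Set (Para p) :=
  {z | slicePt p w z ∈ U}

open Classical in
/-- The restriction `f_ω` of `f : Ω → 𝕆` to `Ω_ω`, in the variables `(x_p, r)`
(set to `0` outside `Ω_ω`, where it is never used). -/
def sliceFun (p : ℕ) {U : Set Octonion} (f : U → Octonion) (w : Octonion) :
    Para p → Octonion :=
  fun z => if h : slicePt p w z ∈ U then f ⟨slicePt p w z, h⟩ else 0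

/-- The set `GSM(Ω)` of left generalized partial-slice monogenic functions of type `p`
on the open set `Ω`: every `f_ω` is `C¹` on `Ω_ω` and `(D_{x_p} + ω ∂_r) f_ω = 0` there. -/
def GSM (p : ℕ) (U : Set Octonion) : Set (U → Octonion) :=
  {f | ∀ w ∈ sphereQ p, ContDiffOn ℝ 1 (sliceFun p f w) (sliceSet p U w) ∧
    ∀ z ∈ sliceSet p U w, DP (sliceFun p f w) z + w * dr (sliceFun p f w) z = 0}

/-! ### Generalized partial-slice regular functions -/

/-- `D` is invariant under the reflection of the last variable. -/
def IsReflInvariant {p : ℕ} (D : Set (Para p)) : Prop :=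
  ∀ (x : EuclideanSpace ℝ (Fin (p + 1))) (r : ℝ), (x, r) ∈ D → (x, -r) ∈ D

/-- The `p`-symmetric completion `Ω_D` of `D`. -/
def completion (p : ℕ) (D : Set (Para p)) : Set Octonion :=
  {y | ∃ w ∈ sphereQ p, ∃ (x : EuclideanSpace ℝ (Fin (p + 1))) (r : ℝ),
    0 ≤ r ∧ (x, r) ∈ D ∧ y = slicePt p w (x, r)}

/-- `F = (F₁, F₂)` is a stem function on `D`: on `D`, `F₁` is even and `F₂` is odd in `r`. -/
def IsStem {p : ℕ} (D : Set (Para p)) (F : Para p → Octonion × Octonion) : Prop :=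
  ∀ (x : EuclideanSpace ℝ (Fin (p + 1))) (r : ℝ), (x, r) ∈ D →
    (F (x, -r)).1 = (F (x, r)).1 ∧ (F (x, -r)).2 = -(F (x, r)).2

/-- The function `I(F)(x) = F₁(x_p, r) + ω F₂(x_p, r)`, where `r = |x_q|` and `ω = x_q / |x_q|`,
on `Ω_D`. If `x_q = 0`, then `F₂(x_p, 0) = 0` for a stem function, so that every `ω` gives the
same value, and so does the junk value `ω = 0` used here (see `induced_slicePt`). -/
def induced (p : ℕ) (D : Set (Para p)) (F : Para p → Octonion × Octonion) :
    completion p D → Octonion :=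
  fun y => (F (projP p y, ‖projQ p y‖)).1 +
    (‖projQ p (y : Octonion)‖⁻¹ • projQ p (y : Octonion)) * (F (projP p y, ‖projQ p y‖)).2

/-- The set `GSR(Ω_D)` of generalized partial-slice regular functions of type `p`: the functions
induced by a `C¹` stem function that satisfies the generalized Cauchy–Riemann equations
`D_{x_p} F₁ - ∂_r F₂ = 0`, `conj(D_{x_p}) F₂ + ∂_r F₁ = 0` on `D`. -/
def GSR (p : ℕ) (D : Set (Para p)) : Set (completion p D → Octonion) :=
  {f | ∃ F : Para p → Octonion × Octonion, IsStem D F ∧ ContDiffOn ℝ 1 F D ∧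
    (∀ z ∈ D, DP (fun u => (F u).1) z - dr (fun u => (F u).2) z = 0 ∧
      DPbar (fun u => (F u).2) z + dr (fun u => (F u).1) z = 0) ∧
    f = induced p D F}

/-! ### `I(F)` is given by `F₁ + ω F₂` for every representation `x = x_p + r ω` -/

theorem mul_apply (x y : Octonion) (k : Fin 8) :
    (x * y) k = ∑ i, ∑ j, (structConst i j k : ℝ) * x i * y j := rfl

theorem projP_slicePt {p : ℕ} (hp : p ≤ 6) {w : Octonion} (hw : w ∈ sphereQ p) (z : Para p) :
    projP p (slicePt p w z) = z.1 := by
  ext i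
  have hi : i.val < 8 := by omega
  have h0 : w ⟨i.val, hi⟩ = 0 := hw.1 _ (by simp; omega)
  have hi2 : i.val ≤ p := by omega
  simp [projP, slicePt, incl, hi, hi2, h0]

theorem projQ_slicePt {p : ℕ} {w : Octonion} (hw : w ∈ sphereQ p) (z : Para p) :
    projQ p (slicePt p w z) = z.2 • w := by
  ext i
  by_cases h : i.val < p + 1
  · have h0 : w i = 0 := hw.1 i (by omega)
    have h1 : i.val ≤ p := by omega
    simp [projQ, h1, h0]
  · have h1 : ¬ i.val ≤ p := by omega
    simp [projQ, slicePt, incl, h1]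

theorem induced_slicePt {p : ℕ} (hp : p ≤ 6) {D : Set (Para p)}
    {F : Para p → Octonion × Octonion} (hF : IsStem D F) {w : Octonion} (hw : w ∈ sphereQ p)
    {x : EuclideanSpace ℝ (Fin (p + 1))} {r : ℝ} (hr : 0 ≤ r) (hz : (x, r) ∈ D)
    (hy : slicePt p w (x, r) ∈ completion p D) :
    induced p D F ⟨slicePt p w (x, r), hy⟩ = (F (x, r)).1 + w * (F (x, r)).2 := by
  have hn : ‖r • w‖ = r := by rw [norm_smul, hw.2, mul_one, Real.norm_of_nonneg hr]
  simp only [induced, projP_slicePt hp hw, projQ_slicePt hw, hn]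
  rcases hr.eq_or_lt with rfl | hr
  · have h2 : (F (x, 0)).2 = 0 := by
      have := (hF x 0 hz).2
      rw [neg_zero] at this
      ext k
      have hk := congrArg (fun v : Octonion => v k) this
      simp only [PiLp.neg_apply] at hk
      simp only [PiLp.zero_apply]
      linarith
    have h3 : ∀ a : Octonion, a * (0 : Octonion) = 0 := by
      intro a; ext k; simp [mul_apply]
    rw [h2, h3, h3]
  · rw [smul_smul, inv_mul_cancel₀ hr.ne', one_smul]

end OctSlice

end

/-! The octonions enter through one identity, `conj_mul_mul_add`: x̄(ya) + ȳ(xa) = 2⟨x,y⟩a. It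
replaces associativity. For ω ∈ 𝕊 it gives ω(ωa) = -a and eᵢ(ωa) = ω(ēᵢa), so (D + ω∂ᵣ)(F₁ + ωF₂) =
(DF₁ - ∂ᵣF₂) + ω(D̄F₂ + ∂ᵣF₁), and regular functions are monogenic (`GSR_subset_GSM`).

Conversely, one slice η = e₇ determines a candidate stem function: the even part of f_η in r, and -η
times its odd part. It satisfies the Cauchy–Riemann system (`stemOf_cauchyRiemann`). For every ω,
f_ω - (F₁ + ωF₂) solves the slice equation on D and vanishes on r = 0. When Ω meets ℝ^{p+1}, D is
connected and meets r = 0, so an identity theorem (`eqOn_zero_of_slice`) makes this difference zero.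

The identity theorem is proved for any first order system ∑ Aⱼ∂ⱼh = 0 with Clifford relations. Such
h is weakly harmonic, hence has the mean value property for a smooth radial kernel. This yields C²
regularity, so that derivatives of solutions are solutions, and interior estimates at all orders. If
h vanishes on a coordinate hyperplane, the equation determines the normal derivative from the
tangential ones, so all derivatives vanish there; Taylor's formula and the estimates then kill h
locally, and connectedness globally.

If Ω misses ℝ^{p+1}, the sign of r is locally constant on D, so the indicator of a single half-slice
is monogenic. It is not regular: at fixed (x_p, r) a regular function is affine in ω, and 𝕊 contains
±e₆ and ±e₇ when p ≤ 5. For p = 6 a connected nonempty Ω must meet ℝ⁷, so this case is vacuous. -/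

open MeasureTheory Metric Set Filter
open scoped Topology InnerProductSpace

/-! ### Clifford systems and weak harmonicity -/

section Clifford

variable {ι V E : Type*} [Fintype ι] [NormedAddCommGroup V] [InnerProductSpace ℝ V]
  [NormedAddCommGroup E] [NormedSpace ℝ E]

/-- Families `A`, `A'` of operators with `A'ₖ Aⱼ + A'ⱼ Aₖ = 2 δⱼₖ`. For such a family, the first
order operator `∑ j, Aⱼ ∂ⱼ` factors the Laplacian. -/
def IsCliffordPair [DecidableEq ι] (A A' : ι → E →L[ℝ] E) : Prop :=
  ∀ j k a, A' k (A j a) + A' j (A k a) = if j = k then (2 : ℝ) • a else 0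

/-- `h` is of class `C¹` on `U` and solves `∑ j, Aⱼ ∂ⱼ h = 0` there, where `∂ⱼ` is the derivative
in the direction of the basis vector `bⱼ`. -/
def IsMonogenicOn (A : ι → E →L[ℝ] E) (b : OrthonormalBasis ι ℝ V) (U : Set V) (h : V → E) :
    Prop :=
  ContDiffOn ℝ 1 h U ∧ ∀ z ∈ U, ∑ j, A j (fderiv ℝ h z (b j)) = 0

theorem IsMonogenicOn.mono {A : ι → E →L[ℝ] E} {b : OrthonormalBasis ι ℝ V} {U U' : Set V}
    {h : V → E} (hh : IsMonogenicOn A b U h) (hU : U' ⊆ U) : IsMonogenicOn A b U' h :=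
  ⟨hh.1.mono hU, fun z hz => hh.2 z (hU hz)⟩

theorem IsMonogenicOn.congr {A : ι → E →L[ℝ] E} {b : OrthonormalBasis ι ℝ V} {U : Set V}
    {h g : V → E} (hh : IsMonogenicOn A b U h) (hU : IsOpen U) (hg : EqOn g h U) :
    IsMonogenicOn A b U g := by
  refine ⟨hh.1.congr hg, fun z hz => ?_⟩
  have : g =ᶠ[𝓝 z] h := hg.eventuallyEq_of_mem (hU.mem_nhds hz)
  rw [this.fderiv_eq]
  exact hh.2 z hz

variable [FiniteDimensional ℝ V] [MeasurableSpace V] [BorelSpace V]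

/-- Mixed integrals of first derivatives are symmetric. -/
theorem integral_fderiv_smul_fderiv_comm {Φ : V → ℝ} {u : V → E} (hΦ : ContDiff ℝ 2 Φ)
    (hΦs : HasCompactSupport Φ) (hu : ContDiff ℝ 1 u) (v w : V) :
    ∫ z, fderiv ℝ Φ z v • fderiv ℝ u z w = ∫ z, fderiv ℝ Φ z w • fderiv ℝ u z v := by
  have hΦ1 : ContDiff ℝ 1 (fderiv ℝ Φ) := hΦ.fderiv_right (by norm_num)
  -- As `u` is only C¹, its derivative is moved onto `Φ`, whose second derivative is symmetric.
  have key : ∀ v w : V, ∫ z, fderiv ℝ Φ z v • fderiv ℝ u z w =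
      - ∫ z, fderiv ℝ (fderiv ℝ Φ) z w v • u z := by
    intro v w
    have hd : ContDiff ℝ 1 (fun z => fderiv ℝ Φ z v) := hΦ1.clm_apply contDiff_const
    have hs : HasCompactSupport (fun z => fderiv ℝ Φ z v) := hΦs.fderiv_apply ℝ v
    have hs' : HasCompactSupport (fun z => fderiv ℝ (fun z => fderiv ℝ Φ z v) z w) :=
      hs.fderiv_apply ℝ w
    have hdu : Continuous fun z => fderiv ℝ u z w :=
      (hu.continuous_fderiv one_ne_zero).clm_apply continuous_const
    have hdd : Continuous fun z => fderiv ℝ (fun z => fderiv ℝ Φ z v) z w :=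
      (hd.continuous_fderiv one_ne_zero).clm_apply continuous_const
    rw [integral_smul_fderiv_eq_neg_fderiv_smul_of_integrable]
    · congr 2
      ext z
      rw [fderiv_clm_apply ((hΦ1.differentiable one_ne_zero) z) (differentiableAt_const v)]
      simp
    · exact (hdd.smul hu.continuous).integrable_of_hasCompactSupport hs'.smul_right
    · exact (hd.continuous.smul hdu).integrable_of_hasCompactSupport hs.smul_right
    · exact (hd.continuous.smul hu.continuous).integrable_of_hasCompactSupport hs.smul_right
    · exact fun x _ => (hd.differentiable one_ne_zero) x
    · exact fun x _ => (hu.differentiable one_ne_zero) x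
  rw [key v w, key w v]
  congr 2
  ext z
  rw [(hΦ.contDiffAt.isSymmSndFDerivAt (by simp)).eq]

/-- A solution of `∑ j, Aⱼ ∂ⱼ u = 0` is weakly harmonic. -/
theorem integral_sum_fderiv_smul_fderiv_eq_zero [CompleteSpace E] [DecidableEq ι]
    {A A' : ι → E →L[ℝ] E}
    (hA : IsCliffordPair A A') (b : OrthonormalBasis ι ℝ V) {Φ : V → ℝ} {u : V → E}
    (hΦ : ContDiff ℝ 2 Φ) (hΦs : HasCompactSupport Φ) (hu : ContDiff ℝ 1 u)
    (hu0 : ∀ z ∈ tsupport Φ, ∑ j, A j (fderiv ℝ u z (b j)) = 0) :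
    ∫ z, ∑ j, fderiv ℝ Φ z (b j) • fderiv ℝ u z (b j) = 0 := by
  have hint : ∀ v w : V, Integrable fun z => fderiv ℝ Φ z v • fderiv ℝ u z w := fun v w =>
    Continuous.integrable_of_hasCompactSupport
      (((hΦ.continuous_fderiv two_ne_zero).clm_apply continuous_const).smul
        ((hu.continuous_fderiv one_ne_zero).clm_apply continuous_const))
      ((hΦs.fderiv_apply ℝ v).smul_right)
  set I : ι → ι → E := fun k j => ∫ z, fderiv ℝ Φ z (b k) • fderiv ℝ u z (b j) with hI
  have hsymm : ∀ k j, I k j = I j k := fun k j =>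
    integral_fderiv_smul_fderiv_comm hΦ hΦs hu _ _
  -- The equation for `u`, weighted by the derivatives of `Φ` and acted on by the `A' k`.
  have h0 : ∑ k, ∑ j, A' k (A j (I k j)) = 0 := by
    have h1 : ∀ k, ∑ j, A j (I k j) = 0 := by
      intro k
      have h2 : ∀ j, A j (I k j) = ∫ z, A j (fderiv ℝ Φ z (b k) • fderiv ℝ u z (b j)) :=
        fun j => ((A j).integral_comp_comm (hint _ _)).symm
      simp_rw [h2]
      rw [← integral_finsetSum _ fun j _ => (A j).integrable_comp (hint _ _)]
      refine integral_eq_zero_of_ae (Eventually.of_forall fun z => ?_)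
      simp only [map_smul, ← Finset.smul_sum, Pi.zero_apply]
      by_cases hz : z ∈ tsupport Φ
      · rw [hu0 z hz, smul_zero]
      · rw [image_eq_zero_of_notMem_tsupport (f := fderiv ℝ Φ)
          (fun h => hz (tsupport_fderiv_subset ℝ h))]
        simp
    simp_rw [← map_sum, h1, map_zero, Finset.sum_const_zero]
  -- Since `I` is symmetric, symmetrising in `(k, j)` leaves only the diagonal, by the Clifford
  -- relations.
  have h2 : (2 : ℝ) • ∑ k, I k k = 0 := by
    have h3 : ∑ k, ∑ j, A' k (A j (I k j)) = ∑ k, ∑ j, A' j (A k (I k j)) := by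
      rw [Finset.sum_comm]
      exact Finset.sum_congr rfl fun j _ => Finset.sum_congr rfl fun k _ => by rw [hsymm k j]
    calc (2 : ℝ) • ∑ k, I k k
        = ∑ k, ∑ j, (A' k (A j (I k j)) + A' j (A k (I k j))) := by
          simp only [hA _ _ _, Finset.smul_sum]
          simp
      _ = 0 := by simp only [Finset.sum_add_distrib, ← h3, h0, add_zero]
  rw [integral_finsetSum _ fun j _ => hint _ _]
  exact (smul_eq_zero.1 h2).resolve_left two_ne_zero

end Clifford

/-! ### A radial averaging kernel -/

section Kernel

variable (V : Type*) [NormedAddCommGroup V] [InnerProductSpace ℝ V]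
  [FiniteDimensional ℝ V] [MeasurableSpace V] [BorelSpace V]

/-- There is a radial averaging kernel `ρ` with `ρ z • z = ∇ Φ z` for a test function `Φ`. -/
theorem exists_radial_kernel : ∃ ρ Φ : V → ℝ, ContDiff ℝ 2 ρ ∧ ContDiff ℝ 2 Φ ∧
    tsupport ρ ⊆ closedBall 0 1 ∧ tsupport Φ ⊆ closedBall 0 1 ∧ ∫ z, ρ z = 1 ∧
    ∀ z v, fderiv ℝ Φ z v = ρ z * ⟪z, v⟫_ℝ := by
  let η : ContDiffBump (0 : ℝ) := ⟨1 / 2, 1, by norm_num, by norm_num⟩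
  have hη0 : ∀ s, 1 ≤ s → η s = 0 := fun s hs =>
    η.zero_of_le_dist (by simpa [η] using hs.trans (le_abs_self s))
  have hηc : ContDiff ℝ 2 η := η.contDiff
  -- Basing the primitive at `1` makes `H (‖z‖ ^ 2)` vanish outside the unit ball. Its gradient is
  -- `2 * η (‖z‖ ^ 2)` times `z`, whence the factor `(2 * c)⁻¹` below.
  let H : ℝ → ℝ := fun s => ∫ x in (1 : ℝ)..s, η x
  have hH : ∀ s, HasDerivAt H (η s) s := fun s =>
    intervalIntegral.integral_hasDerivAt_right (η.continuous.intervalIntegrable _ _)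
      (η.continuous.stronglyMeasurableAtFilter _ _) η.continuous.continuousAt
  have hH0 : ∀ s, 1 ≤ s → H s = 0 := fun s hs => by
    refine intervalIntegral.integral_zero_ae (Eventually.of_forall fun x hx => hη0 x ?_)
    rw [uIoc_of_le hs] at hx
    exact hx.1.le
  have hHc : ContDiff ℝ 2 H := by
    rw [show (2 : WithTop ℕ∞) = 1 + 1 by norm_num, contDiff_succ_iff_deriv]
    refine ⟨fun s => (hH s).differentiableAt, by simp, ?_⟩
    rw [show deriv H = η from funext fun s => (hH s).deriv]
    exact η.contDiff
  have hsupp : ∀ g : ℝ → ℝ, (∀ s, 1 ≤ s → g s = 0) →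
      tsupport (fun z : V => g (‖z‖ ^ 2)) ⊆ closedBall 0 1 := by
    refine fun g hg => closure_minimal (fun z hz => ?_) isClosed_closedBall
    rw [mem_closedBall_zero_iff]
    by_contra! h
    exact hz (hg _ (by nlinarith))
  have hcs : HasCompactSupport fun z : V => η (‖z‖ ^ 2) :=
    (isCompact_closedBall (0 : V) 1).of_isClosed_subset (isClosed_tsupport _) (hsupp η hη0)
  have hρc : ContDiff ℝ 2 fun z : V => η (‖z‖ ^ 2) := hηc.comp (contDiff_norm_sq ℝ)
  have hΦc : ContDiff ℝ 2 fun z : V => H (‖z‖ ^ 2) := hHc.comp (contDiff_norm_sq ℝ)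
  have hpos : 0 < ∫ z : V, η (‖z‖ ^ 2) := by
    refine hρc.continuous.integral_pos_of_hasCompactSupport_nonneg_nonzero (x := 0) hcs
      (fun z => η.nonneg) ?_
    have : η (‖(0 : V)‖ ^ 2) = 1 := η.one_of_mem_closedBall (by simp [η])
    rw [this]
    exact one_ne_zero
  set c := ∫ z : V, η (‖z‖ ^ 2) with hc
  refine ⟨fun z => c⁻¹ * η (‖z‖ ^ 2), fun z => (2 * c)⁻¹ * H (‖z‖ ^ 2), contDiff_const.mul hρc,
    contDiff_const.mul hΦc, hsupp (fun s => c⁻¹ * η s) fun s hs => by simp [hη0 s hs],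
    hsupp (fun s => (2 * c)⁻¹ * H s) fun s hs => by simp [hH0 s hs], ?_, fun z v => ?_⟩
  · rw [integral_const_mul, ← hc, inv_mul_cancel₀ hpos.ne']
  · have h1 : HasFDerivAt (fun z : V => (2 * c)⁻¹ * H (‖z‖ ^ 2)) _ z :=
      (((hH _).comp_hasFDerivAt z (hasStrictFDerivAt_norm_sq z).hasFDerivAt).const_mul (2 * c)⁻¹)
    rw [h1.fderiv]
    simp
    field_simp

end Kernel

/-! ### The mean value property -/

section MeanValue

variable {ι V E : Type*} [Fintype ι] [NormedAddCommGroup V] [InnerProductSpace ℝ V]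
  [NormedAddCommGroup E] [NormedSpace ℝ E]
  [FiniteDimensional ℝ V] [MeasurableSpace V] [BorelSpace V]

/-- The derivative of weighted averages of dilations of a `C¹` function with compact support. -/
theorem hasDerivAt_integral_smul_comp_add_smul {ρ : V → ℝ} (hρ : Continuous ρ)
    (hρs : HasCompactSupport ρ) {h : V → E} (hh : ContDiff ℝ 1 h) (hhs : HasCompactSupport h)
    (y : V) (t : ℝ) :
    HasDerivAt (fun t : ℝ => ∫ z, ρ z • h (y + t • z)) (∫ z, ρ z • fderiv ℝ h (y + t • z) z) t := by
  obtain ⟨K, hK⟩ := (hh.continuous_fderiv one_ne_zero).bounded_above_of_compact_support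
    (hhs.fderiv ℝ)
  have hc : ∀ t : ℝ, Continuous fun z => ρ z • h (y + t • z) := fun t =>
    hρ.smul (hh.continuous.comp (by fun_prop))
  have hc' : Continuous fun z => ρ z • fderiv ℝ h (y + t • z) z :=
    hρ.smul (((hh.continuous_fderiv one_ne_zero).comp (by fun_prop)).clm_apply continuous_id)
  refine (hasDerivAt_integral_of_dominated_loc_of_deriv_le
    (F' := fun (t : ℝ) z => ρ z • fderiv ℝ h (y + t • z) z)
    (bound := fun z => ‖ρ z‖ * (K * ‖z‖)) (s := univ) univ_mem
    (Eventually.of_forall fun t => (hc t).aestronglyMeasurable)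
    ((hc t).integrable_of_hasCompactSupport hρs.smul_right) hc'.aestronglyMeasurable
    (Eventually.of_forall fun z t _ => ?_) ?_ (Eventually.of_forall fun z t _ => ?_)).2
  · rw [norm_smul]
    gcongr
    exact (ContinuousLinearMap.le_opNorm _ _).trans (by gcongr; exact hK _)
  · exact Continuous.integrable_of_hasCompactSupport (by fun_prop) hρs.norm.mul_right
  · have h1 : HasDerivAt (fun t : ℝ => y + t • z) z t := by
      simpa using ((hasDerivAt_id t).smul_const z).const_add y
    exact (((hh.differentiable one_ne_zero) _).hasFDerivAt.comp_hasDerivAt t h1).const_smul (ρ z)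

/-- The mean value property of the solutions of `∑ j, Aⱼ ∂ⱼ h = 0`, for a radial kernel. -/
theorem integral_radial_kernel_smul_eq [CompleteSpace E] [DecidableEq ι]
    {A A' : ι → E →L[ℝ] E} (hA : IsCliffordPair A A') (b : OrthonormalBasis ι ℝ V) {ρ Φ : V → ℝ}
    (hρ : ContDiff ℝ 2 ρ) (hΦ : ContDiff ℝ 2 Φ) (hρs : tsupport ρ ⊆ closedBall 0 1)
    (hΦs : tsupport Φ ⊆ closedBall 0 1) (hρ1 : ∫ z, ρ z = 1)
    (hρΦ : ∀ z v, fderiv ℝ Φ z v = ρ z * ⟪z, v⟫_ℝ) {h : V → E} (hh : ContDiff ℝ 1 h)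
    (hhs : HasCompactSupport h) {y : V} {R : ℝ}
    (hy : ∀ z ∈ ball y R, ∑ j, A j (fderiv ℝ h z (b j)) = 0) {t : ℝ} (ht : |t| < R) :
    ∫ z, ρ z • h (y + t • z) = h y := by
  have hcρ : HasCompactSupport ρ :=
    (isCompact_closedBall (0 : V) 1).of_isClosed_subset (isClosed_tsupport _) hρs
  have hcΦ : HasCompactSupport Φ :=
    (isCompact_closedBall (0 : V) 1).of_isClosed_subset (isClosed_tsupport _) hΦs
  set G : ℝ → E := fun t => ∫ z, ρ z • h (y + t • z) with hG
  have hd := fun t : ℝ => hasDerivAt_integral_smul_comp_add_smul hρ.continuous hcρ hh hhs y t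
  have hzero : ∀ t ∈ ball (0 : ℝ) R, ∫ z, ρ z • fderiv ℝ h (y + t • z) z = 0 := by
    intro t ht
    rw [mem_ball_zero_iff, Real.norm_eq_abs] at ht
    have hmem : ∀ z ∈ closedBall (0 : V) 1, y + t • z ∈ ball y R := by
      intro z hz
      rw [mem_closedBall_zero_iff] at hz
      rw [mem_ball, dist_eq_norm, add_sub_cancel_left, norm_smul, Real.norm_eq_abs]
      nlinarith [abs_nonneg t]
    -- Weak harmonicity is applied to the rescaling `t⁻¹ • h (y + t • z)`, replaced at `t = 0` by
    -- its linear counterpart. As `ρ z • z` is the gradient of `Φ`, the resulting integral is the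
    -- derivative of `G` at `t`.
    obtain ⟨u, hu, hud⟩ : ∃ u : V → E, ContDiff ℝ 1 u ∧
        ∀ z, fderiv ℝ u z = fderiv ℝ h (y + t • z) := by
      rcases eq_or_ne t 0 with rfl | ht0
      · exact ⟨fderiv ℝ h y, (fderiv ℝ h y).contDiff, fun z => by simp⟩
      · refine ⟨fun z => t⁻¹ • h (y + t • z), contDiff_const.smul
          (hh.comp (contDiff_const.add (contDiff_const.smul contDiff_id))), fun z => ?_⟩
        have h1 : HasFDerivAt (fun z : V => y + t • z) (t • ContinuousLinearMap.id ℝ V) z :=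
          ((hasFDerivAt_id z).const_smul t).const_add y
        have h2 := ((((hh.differentiable one_ne_zero) _).hasFDerivAt.comp z h1).const_smul t⁻¹)
        refine h2.fderiv.trans ?_
        ext v
        simp [smul_smul, ht0]
    have h0 := integral_sum_fderiv_smul_fderiv_eq_zero hA b hΦ hcΦ hu
      (fun z hz => by rw [hud]; exact hy _ (hmem z (hΦs hz)))
    rw [← h0]
    congr 1
    ext z
    have hz : ∑ j, ⟪z, b j⟫_ℝ • b j = z :=
      (Finset.sum_congr rfl fun j _ => by rw [real_inner_comm]).trans (b.sum_repr' z)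
    simp_rw [hρΦ, hud, mul_smul, ← Finset.smul_sum, ← map_smul, ← map_sum, hz, map_smul]
  have hR : 0 < R := (abs_nonneg t).trans_lt ht
  have hconst : G t = G 0 := isOpen_ball.is_const_of_deriv_eq_zero
    (convex_ball (0 : ℝ) R).isPreconnected (fun s _ => (hd s).differentiableAt.differentiableWithinAt)
    (fun s hs => by rw [(hd s).deriv, hzero s hs]; rfl) (by simpa using ht) (by simpa using hR)
  refine hconst.trans ?_
  simp only [hG, zero_smul, add_zero]
  rw [integral_smul_const, hρ1, one_smul]

end MeanValue

/-! ### Regularity and the first interior estimate -/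

section Regularity

variable {ι V E : Type*} [Fintype ι] [NormedAddCommGroup V] [InnerProductSpace ℝ V]
  [NormedAddCommGroup E] [NormedSpace ℝ E] [FiniteDimensional ℝ V]

/-- A function of class `Cⁿ` near a closed ball agrees on a smaller ball with a compactly supported
function of class `Cⁿ`. -/
theorem ContDiffOn.exists_contDiff_eqOn_closedBall {n : ℕ∞} {U : Set V} (hU : IsOpen U)
    {h : V → E} (hh : ContDiffOn ℝ n h U) {y : V} {r s : ℝ} (hr : 0 < r) (hrs : r < s)
    (hs : closedBall y s ⊆ U) :
    ∃ g : V → E, ContDiff ℝ n g ∧ HasCompactSupport g ∧ EqOn g h (closedBall y r) := by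
  let χ : ContDiffBump y := ⟨r, s, hr, hrs⟩
  refine ⟨fun z => χ z • h z, contDiff_iff_contDiffAt.2 fun z => ?_, χ.hasCompactSupport.smul_right,
    fun z hz => ?_⟩
  · by_cases hz : z ∈ tsupport fun z => χ z • h z
    · have hz' : z ∈ U := by
        have := (tsupport_smul_subset_left χ h) hz
        rw [χ.tsupport_eq] at this
        exact hs this
      exact χ.contDiffAt.smul (hh.contDiffAt (hU.mem_nhds hz'))
    · exact contDiffAt_const.congr_of_eventuallyEq (notMem_tsupport_iff_eventuallyEq.1 hz)
  · simp only [χ.one_of_mem_closedBall hz, one_smul]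

variable [MeasurableSpace V] [BorelSpace V]

/-- Averages of dilations of a continuous function over a smooth kernel are smooth in the centre. -/
theorem contDiff_integral_smul_comp_add_smul {n : ℕ∞} {ρ : V → ℝ} (hρ : ContDiff ℝ n ρ)
    (hρs : HasCompactSupport ρ) {h : V → E} (hh : Continuous h) {t : ℝ} (ht : t ≠ 0) :
    ContDiff ℝ n fun x => ∫ z, ρ z • h (x + t • z) := by
  have ht' : (-t)⁻¹ ≠ 0 := inv_ne_zero (neg_ne_zero.2 ht)
  have hconv : ContDiff ℝ n (convolution (fun w => ρ ((-t)⁻¹ • w)) h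
      (ContinuousLinearMap.lsmul ℝ ℝ) volume) :=
    (hρs.comp_smul ht').contDiff_convolution_left _
      (hρ.comp (contDiff_const.smul contDiff_id)) hh.locallyIntegrable
  -- The substitution `w = -t • z` turns the average into a convolution with a dilated kernel, up to
  -- the Jacobian.
  have : (fun x => ∫ z, ρ z • h (x + t • z)) =
      fun x => |(-t) ^ Module.finrank ℝ V|⁻¹ • convolution (fun w => ρ ((-t)⁻¹ • w)) h
        (ContinuousLinearMap.lsmul ℝ ℝ) volume x := by
    ext x
    rw [convolution_def]
    have h1 := Measure.integral_comp_inv_smul volume (fun z => ρ z • h (x + t • z)) (-t)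
    rw [eq_inv_smul_iff₀ (abs_pos.2 (pow_ne_zero _ (neg_ne_zero.2 ht))).ne', ← h1]
    congr 1
    ext w
    have : t • ((-t)⁻¹ • w) = -w := by
      rw [smul_smul, inv_neg, mul_neg, mul_inv_cancel₀ ht, neg_one_smul]
    simp only [ContinuousLinearMap.lsmul_apply, this, sub_eq_add_neg]
  rw [this]
  exact contDiff_const.smul hconv

variable [CompleteSpace E] [DecidableEq ι] {A A' : ι → E →L[ℝ] E} {b : OrthonormalBasis ι ℝ V}
  {U : Set V} {h : V → E}

/-- By the mean value property, `h` is locally an average, at a fixed scale, of a cut-off `g` of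
itself; the average inherits the regularity of the kernel. Centres within `ε / 4` and scale `ε / 8`
stay where `g = h`. -/
theorem IsMonogenicOn.contDiffOn_two (hA : IsCliffordPair A A') (hU : IsOpen U)
    (hh : IsMonogenicOn A b U h) : ContDiffOn ℝ 2 h U := by
  obtain ⟨ρ, Φ, hρ, hΦ, hρs, hΦs, hρ1, hρΦ⟩ := exists_radial_kernel V
  have hcρ : HasCompactSupport ρ :=
    (isCompact_closedBall (0 : V) 1).of_isClosed_subset (isClosed_tsupport _) hρs
  intro y hy
  obtain ⟨ε, hε, hεU⟩ := nhds_basis_closedBall.mem_iff.1 (hU.mem_nhds hy)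
  obtain ⟨g, hg, hgs, hgh⟩ := ContDiffOn.exists_contDiff_eqOn_closedBall (n := 1) hU hh.1
    (half_pos hε) (half_lt_self hε) hεU
  have hm : IsMonogenicOn A b (ball y (ε / 2)) g :=
    (hh.mono ((ball_subset_closedBall.trans (closedBall_subset_closedBall
      (half_le_self hε.le))).trans hεU)).congr isOpen_ball (hgh.mono ball_subset_closedBall)
  have hmv : ∀ x ∈ ball y (ε / 4), ∫ z, ρ z • g (x + (ε / 8) • z) = h x := by
    intro x hx
    rw [integral_radial_kernel_smul_eq hA b hρ hΦ hρs hΦs hρ1 hρΦ hg hgs (y := x) (R := ε / 4)]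
    · exact hgh (ball_subset_closedBall (ball_subset_ball (by linarith) hx))
    · refine fun z hz => hm.2 z ?_
      rw [mem_ball] at *
      linarith [dist_triangle z x y]
    · rw [abs_of_pos] <;> linarith
  have hC : ContDiff ℝ 2 fun x => ∫ z, ρ z • g (x + (ε / 8) • z) :=
    contDiff_integral_smul_comp_add_smul (n := 2) hρ hcρ hg.continuous (by positivity)
  refine (hC.contDiffAt.congr_of_eventuallyEq ?_).contDiffWithinAt
  filter_upwards [ball_mem_nhds y (show 0 < ε / 4 by positivity)] with x hx
  exact (hmv x hx).symm

/-- The coefficients are constant, so the equation can be differentiated; C² regularity allows the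
two derivatives to be exchanged. -/
theorem IsMonogenicOn.fderiv_apply (hA : IsCliffordPair A A') (hU : IsOpen U)
    (hh : IsMonogenicOn A b U h) (v : V) : IsMonogenicOn A b U fun z => fderiv ℝ h z v := by
  have h2 := hh.contDiffOn_two hA hU
  have hd : ContDiffOn ℝ 1 (fderiv ℝ h) U := h2.fderiv_of_isOpen hU (by norm_num)
  refine ⟨hd.clm_apply contDiffOn_const, fun z hz => ?_⟩
  have hdz : DifferentiableAt ℝ (fderiv ℝ h) z :=
    (hd.contDiffAt (hU.mem_nhds hz)).differentiableAt one_ne_zero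
  have hz2 : IsSymmSndFDerivAt ℝ h z :=
    (h2.contDiffAt (hU.mem_nhds hz)).isSymmSndFDerivAt (by simp)
  have hev : (fun z => ∑ j, A j (fderiv ℝ h z (b j))) =ᶠ[𝓝 z] fun _ => 0 := by
    filter_upwards [hU.mem_nhds hz] with x hx using hh.2 x hx
  have hsum : HasFDerivAt (fun z => ∑ j, A j (fderiv ℝ h z (b j)))
      (∑ j, (A j).comp ((fderiv ℝ (fderiv ℝ h) z).flip (b j))) z :=
    HasFDerivAt.fun_sum fun j _ => (A j).hasFDerivAt.comp z
      (by simpa using hdz.hasFDerivAt.clm_apply (hasFDerivAt_const (b j) z))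
  have h0 : (∑ j, (A j).comp ((fderiv ℝ (fderiv ℝ h) z).flip (b j))) v = 0 := by
    rw [← hsum.fderiv, hev.fderiv_eq]
    simp
  rw [← h0, _root_.sum_apply]
  refine Finset.sum_congr rfl fun j _ => ?_
  rw [fderiv_clm_apply hdz (differentiableAt_const v)]
  simp [hz2.eq (b j) v]

/-- Interior estimate for the first derivatives. -/
theorem exists_norm_fderiv_apply_le (hA : IsCliffordPair A A') (b : OrthonormalBasis ι ℝ V) :
    ∃ C : ℝ, 0 < C ∧ ∀ {U : Set V} {h : V → E}, IsOpen U → IsMonogenicOn A b U h →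
      ∀ {y : V} {s M : ℝ}, 0 < s → closedBall y s ⊆ U → (∀ x ∈ closedBall y s, ‖h x‖ ≤ M) →
      ∀ v, ‖fderiv ℝ h y v‖ ≤ C * ‖v‖ / s * M := by
  obtain ⟨ρ, Φ, hρ, hΦ, hρs, hΦs, hρ1, hρΦ⟩ := exists_radial_kernel V
  have hcρ : HasCompactSupport ρ :=
    (isCompact_closedBall (0 : V) 1).of_isClosed_subset (isClosed_tsupport _) hρs
  have hdρ : Continuous (fderiv ℝ ρ) := hρ.continuous_fderiv two_ne_zero
  have hC0 : 0 ≤ ∫ z, ‖fderiv ℝ ρ z‖ := integral_nonneg fun z => norm_nonneg _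
  -- The `4` comes from averaging at scale `s / 4`; the `+ 1` only ensures positivity.
  refine ⟨4 * ((∫ z, ‖fderiv ℝ ρ z‖) + 1), by positivity, ?_⟩
  intro U h hU hh y s M hs hsU hM v
  have hM0 : 0 ≤ M := (norm_nonneg _).trans (hM y (mem_closedBall_self hs.le))
  obtain ⟨g, hg, hgs, hgh⟩ := ContDiffOn.exists_contDiff_eqOn_closedBall (n := 2) hU
    (hh.contDiffOn_two hA hU) (half_pos hs) (half_lt_self hs) hsU
  have hm : IsMonogenicOn A b (ball y (s / 2)) g :=
    (hh.mono ((ball_subset_closedBall.trans (closedBall_subset_closedBall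
      (half_le_self hs.le))).trans hsU)).congr isOpen_ball (hgh.mono ball_subset_closedBall)
  have hgd : ContDiff ℝ 1 fun z => fderiv ℝ g z v :=
    (hg.fderiv_right (m := 1) (by norm_num)).clm_apply contDiff_const
  have hmem : ∀ z ∈ closedBall (0 : V) 1, y + (s / 4) • z ∈ ball y (s / 2) := by
    intro z hz
    rw [mem_closedBall_zero_iff] at hz
    rw [mem_ball, dist_eq_norm, add_sub_cancel_left, norm_smul, Real.norm_of_nonneg (by linarith)]
    nlinarith
  -- The derivative is itself a solution, so it has the mean value property; integrating by parts
  -- then moves the derivative to `ρ`.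
  have hmv : ∫ z, ρ z • fderiv ℝ g (y + (s / 4) • z) v = fderiv ℝ g y v :=
    integral_radial_kernel_smul_eq hA b hρ hΦ hρs hΦs hρ1 hρΦ hgd (hgs.fderiv_apply ℝ v)
      (R := s / 2) (hm.fderiv_apply hA isOpen_ball v).2 (by rw [abs_of_pos] <;> linarith)
  have hgy : fderiv ℝ h y v = fderiv ℝ g y v := by
    have : g =ᶠ[𝓝 y] h := hgh.eventuallyEq_of_mem (closedBall_mem_nhds y (half_pos hs))
    rw [this.fderiv_eq]
  set u : V → E := fun z => g (y + (s / 4) • z) with hu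
  have huc : ContDiff ℝ 2 u :=
    hg.comp (contDiff_const.add (contDiff_const.smul contDiff_id))
  have hud : ∀ z, fderiv ℝ u z v = (s / 4) • fderiv ℝ g (y + (s / 4) • z) v := by
    intro z
    have h1 : HasFDerivAt (fun z : V => y + (s / 4) • z) ((s / 4) • ContinuousLinearMap.id ℝ V) z :=
      ((hasFDerivAt_id z).const_smul (s / 4)).const_add y
    have h2 : HasFDerivAt u _ z := ((hg.differentiable two_ne_zero) _).hasFDerivAt.comp z h1
    rw [h2.fderiv]
    simp
  have hibp : ∫ z, ρ z • fderiv ℝ u z v = -∫ z, fderiv ℝ ρ z v • u z := by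
    refine integral_smul_fderiv_eq_neg_fderiv_smul_of_integrable ?_ ?_ ?_
      (fun x _ => (hρ.differentiable two_ne_zero) x) (fun x _ => (huc.differentiable two_ne_zero) x)
    · exact ((hdρ.clm_apply continuous_const).smul huc.continuous).integrable_of_hasCompactSupport
        (hcρ.fderiv_apply ℝ v).smul_right
    · exact (hρ.continuous.smul ((huc.continuous_fderiv two_ne_zero).clm_apply
        continuous_const)).integrable_of_hasCompactSupport hcρ.smul_right
    · exact (hρ.continuous.smul huc.continuous).integrable_of_hasCompactSupport hcρ.smul_right
  have heq : (s / 4) • fderiv ℝ h y v = -∫ z, fderiv ℝ ρ z v • u z := by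
    rw [← hibp, hgy, ← hmv, ← integral_smul]
    congr 1
    ext z
    rw [hud, smul_comm]
  have hbound : ‖∫ z, fderiv ℝ ρ z v • u z‖ ≤ ∫ z, ‖fderiv ℝ ρ z‖ * (‖v‖ * M) := by
    refine norm_integral_le_of_norm_le ?_ (Eventually.of_forall fun z => ?_)
    · exact ((hdρ.norm.integrable_of_hasCompactSupport (hcρ.fderiv ℝ).norm)).mul_const _
    · by_cases hz : z ∈ tsupport ρ
      · have hmz := ball_subset_closedBall (hmem z (hρs hz))
        have : ‖u z‖ ≤ M := by
          rw [hu]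
          simp only [hgh hmz]
          exact hM _ (closedBall_subset_closedBall (half_le_self hs.le) hmz)
        rw [norm_smul, ← mul_assoc]
        gcongr
        exact ContinuousLinearMap.le_opNorm _ _
      · rw [image_eq_zero_of_notMem_tsupport (f := fderiv ℝ ρ)
          (fun h => hz (tsupport_fderiv_subset ℝ h))]
        simp
  rw [integral_mul_const] at hbound
  have h3 : s / 4 * ‖fderiv ℝ h y v‖ ≤ (∫ z, ‖fderiv ℝ ρ z‖) * (‖v‖ * M) := by
    rw [← Real.norm_of_nonneg (show 0 ≤ s / 4 by linarith), ← norm_smul, heq, norm_neg]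
    exact hbound
  have h4 : 0 ≤ ‖v‖ * M := by positivity
  rw [div_mul_eq_mul_div, le_div_iff₀ hs]
  nlinarith

end Regularity

/-! ### The identity theorem -/

section Identity

/-- If all derivatives of a function of one variable vanish at `0`, then Taylor's formula bounds the
function by any of its derivatives. -/
theorem norm_le_pow_div_factorial_of_hasDerivAt {E : Type*} [NormedAddCommGroup E]
    [NormedSpace ℝ E] (n : ℕ) {g : ℕ → ℝ → E} {K : ℝ}
    (hg : ∀ k, ∀ s ∈ Icc (0 : ℝ) 1, HasDerivAt (g k) (g (k + 1) s) s) (hg0 : ∀ k, g k 0 = 0)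
    (hK : ∀ s ∈ Icc (0 : ℝ) 1, ‖g n s‖ ≤ K) :
    ∀ s ∈ Icc (0 : ℝ) 1, ‖g 0 s‖ ≤ K * s ^ n / n.factorial := by
  induction n generalizing g with
  | zero => simpa using hK
  | succ n ih =>
    have h1 := ih (g := fun k => g (k + 1)) (fun k => hg (k + 1)) (fun k => hg0 (k + 1)) hK
    refine image_norm_le_of_norm_deriv_right_le_deriv_boundary
      (B' := fun s => K * s ^ n / n.factorial)
      (fun s hs => (hg 0 s hs).continuousAt.continuousWithinAt)
      (fun s hs => (hg 0 s (Ico_subset_Icc_self hs)).hasDerivWithinAt) (by simp [hg0])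
      (fun s => ?_) (fun s hs => h1 s (Ico_subset_Icc_self hs))
    have h2 := (((hasDerivAt_id s).pow (n + 1)).const_mul K).div_const ((n + 1).factorial : ℝ)
    refine h2.congr_deriv ?_
    rw [Nat.factorial_succ]
    have : (n.factorial : ℝ) ≠ 0 := by positivity
    push_cast
    simp only [id, mul_one]
    field_simp

variable {ι V E : Type*} [Fintype ι] [NormedAddCommGroup V] [InnerProductSpace ℝ V]
  [NormedAddCommGroup E] [NormedSpace ℝ E]

/-- The operator that takes the derivative in the direction of `v`. -/
noncomputable def dirDeriv (v : V) (h : V → E) : V → E := fun z => fderiv ℝ h z v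

theorem dirDeriv_iterate_eventuallyEq_zero {h : V → E} {y : V} (hh : h =ᶠ[𝓝 y] 0) (v : V) (k : ℕ) :
    (dirDeriv v)^[k] h =ᶠ[𝓝 y] 0 := by
  induction k generalizing h with
  | zero => exact hh
  | succ k ih =>
    refine ih ?_
    filter_upwards [hh.eventually_nhds] with x hx
    have hx' : h =ᶠ[𝓝 x] fun _ => 0 := hx
    simp [dirDeriv, hx'.fderiv_eq]

variable [FiniteDimensional ℝ V] [MeasurableSpace V] [BorelSpace V]
  [CompleteSpace E] [DecidableEq ι] {A A' : ι → E →L[ℝ] E} {b : OrthonormalBasis ι ℝ V}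
  {U : Set V} {h : V → E}

theorem IsMonogenicOn.dirDeriv_iterate (hA : IsCliffordPair A A') (hU : IsOpen U)
    (hh : IsMonogenicOn A b U h) (v : V) (k : ℕ) : IsMonogenicOn A b U ((dirDeriv v)^[k] h) := by
  induction k with
  | zero => exact hh
  | succ k ih =>
    rw [Function.iterate_succ_apply']
    exact ih.fderiv_apply hA hU v

/-- Interior estimates for all derivatives. -/
theorem exists_norm_dirDeriv_iterate_le (hA : IsCliffordPair A A') (b : OrthonormalBasis ι ℝ V) :
    ∃ C : ℝ, 0 < C ∧ ∀ {U : Set V}, IsOpen U → ∀ (k : ℕ) {h : V → E}, IsMonogenicOn A b U h →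
      ∀ {y : V} {a M : ℝ}, 0 < a → closedBall y (k * a) ⊆ U →
      (∀ x ∈ closedBall y (k * a), ‖h x‖ ≤ M) →
      ∀ v, ‖(dirDeriv v)^[k] h y‖ ≤ (C * ‖v‖ / a) ^ k * M := by
  obtain ⟨C, hC, hest⟩ := exists_norm_fderiv_apply_le hA b
  refine ⟨C, hC, fun {U} hU k => ?_⟩
  induction k with
  | zero => exact fun {h} _ {y a M} _ _ hM v => by simpa using hM y (by simp)
  | succ k ih =>
    intro h hh y a M ha hy hM v
    -- Each differentiation uses up one shell of width `a`.
    have hsub : ∀ x ∈ closedBall y (k * a), closedBall x a ⊆ closedBall y ((k + 1 : ℕ) * a) := by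
      intro x hx
      refine closedBall_subset_closedBall' ?_
      rw [mem_closedBall] at hx
      push_cast
      linarith
    have h1 : ∀ x ∈ closedBall y (k * a), ‖dirDeriv v h x‖ ≤ C * ‖v‖ / a * M := fun x hx =>
      hest hU hh ha ((hsub x hx).trans hy) (fun z hz => hM z (hsub x hx hz)) v
    have h2 : closedBall y (k * a) ⊆ U := by
      refine (closedBall_subset_closedBall ?_).trans hy
      push_cast
      linarith
    rw [Function.iterate_succ_apply]
    refine (ih (hh.fderiv_apply hA hU v) ha h2 h1 v).trans_eq ?_
    ring

/-- A solution all of whose derivatives vanish at a point vanishes near that point. -/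
theorem IsMonogenicOn.eventuallyEq_zero (hA : IsCliffordPair A A') (hU : IsOpen U)
    (hh : IsMonogenicOn A b U h) {y : V} (hy : y ∈ U) (h0 : ∀ v k, (dirDeriv v)^[k] h y = 0) :
    h =ᶠ[𝓝 y] 0 := by
  obtain ⟨C, hC, hest⟩ := exists_norm_dirDeriv_iterate_le hA b
  obtain ⟨ε, hε, hεU⟩ := nhds_basis_closedBall.mem_iff.1 (hU.mem_nhds hy)
  obtain ⟨M, hM⟩ := (isCompact_closedBall y ε).exists_bound_of_continuousOn
    (hh.1.continuousOn.mono hεU)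
  set δ := ε / 2 with hδ
  have hδ0 : 0 < δ := half_pos hε
  set c := C * Real.exp 1 / δ with hc
  have hc0 : 0 < c := by positivity
  -- The radius `δ` keeps the segment and its `δ`-balls inside the `ε`-ball; `c⁻¹` makes `c * ‖v‖ <
  -- 1`.
  filter_upwards [ball_mem_nhds y (lt_min hδ0 (inv_pos.2 hc0))] with x hx
  set v := x - y with hv
  have hvn : ‖v‖ < min δ c⁻¹ := by rwa [mem_ball, dist_eq_norm] at hx
  have hvδ : ‖v‖ < δ := hvn.trans_le (min_le_left _ _)
  have hvc : ‖v‖ < c⁻¹ := hvn.trans_le (min_le_right _ _)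
  have hball : ∀ s ∈ Icc (0 : ℝ) 1, closedBall (y + s • v) δ ⊆ closedBall y ε := by
    intro s hs
    refine closedBall_subset_closedBall' ?_
    rw [dist_eq_norm, add_sub_cancel_left, norm_smul, Real.norm_of_nonneg hs.1]
    nlinarith [norm_nonneg v, hs.2]
  have hderiv : ∀ k, ∀ s ∈ Icc (0 : ℝ) 1, HasDerivAt (fun s : ℝ => (dirDeriv v)^[k] h (y + s • v))
      ((dirDeriv v)^[k + 1] h (y + s • v)) s := by
    intro k s hs
    have h1 : HasDerivAt (fun s : ℝ => y + s • v) v s := by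
      simpa using ((hasDerivAt_id s).smul_const v).const_add y
    have h2 := ((hh.dirDeriv_iterate hA hU v k).1.contDiffAt
      (hU.mem_nhds (hεU (hball s hs (mem_closedBall_self hδ0.le))))).differentiableAt one_ne_zero
    rw [Function.iterate_succ_apply']
    exact h2.hasFDerivAt.comp_hasDerivAt s h1
  have hxy : x = y + (1 : ℝ) • v := by simp [hv]
  -- Dividing `δ` into `k + 1` shells costs `(k + 1) ^ (k + 1)`, which the factorial in Taylor's
  -- formula absorbs up to `Real.exp 1 ^ (k + 1)`.
  have hbound : ∀ k : ℕ, ‖h x‖ ≤ (c * ‖v‖) ^ (k + 1) * M := by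
    intro k
    have hM0 : 0 ≤ M := (norm_nonneg _).trans (hM y (mem_closedBall_self hε.le))
    have hk : (0 : ℝ) < (k + 1 : ℕ) := by positivity
    have h1 := norm_le_pow_div_factorial_of_hasDerivAt (k + 1)
      (g := fun k s => (dirDeriv v)^[k] h (y + s • v))
      (K := (C * ‖v‖ / (δ / (k + 1 : ℕ))) ^ (k + 1) * M) hderiv (fun k => by simpa using h0 v k)
      (fun s hs => by
        have hka : ((k + 1 : ℕ) : ℝ) * (δ / (k + 1 : ℕ)) = δ := by field_simp
        refine hest hU (k + 1) hh (div_pos hδ0 hk) ?_ ?_ v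
        · rw [hka]
          exact (hball s hs).trans hεU
        · rw [hka]
          exact fun z hz => hM z (hball s hs hz)) 1 (by simp)
    have h2 : ((k + 1 : ℕ) : ℝ) ^ (k + 1) / (k + 1).factorial ≤ Real.exp 1 ^ (k + 1) := by
      rw [← Real.exp_nat_mul, mul_one]
      exact Real.pow_div_factorial_le_exp _ hk.le _
    rw [hxy]
    refine h1.trans ?_
    calc (C * ‖v‖ / (δ / (k + 1 : ℕ))) ^ (k + 1) * M * 1 ^ (k + 1) / (k + 1).factorial
        = (C * ‖v‖ / δ) ^ (k + 1) * M * (((k + 1 : ℕ) : ℝ) ^ (k + 1) / (k + 1).factorial) := by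
          rw [div_div_eq_mul_div, mul_div_right_comm (C * ‖v‖), mul_pow, one_pow]
          ring
      _ ≤ (C * ‖v‖ / δ) ^ (k + 1) * M * Real.exp 1 ^ (k + 1) := by gcongr
      _ = (c * ‖v‖) ^ (k + 1) * M := by
          rw [hc, mul_right_comm, ← mul_pow]
          congr 2
          ring
  have hlt : c * ‖v‖ < 1 := by
    have := mul_lt_mul_of_pos_left hvc hc0
    rwa [mul_inv_cancel₀ hc0.ne'] at this
  have hlim : Tendsto (fun k : ℕ => (c * ‖v‖) ^ (k + 1) * M) atTop (𝓝 0) := by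
    simpa using ((tendsto_pow_atTop_nhds_zero_of_lt_one (by positivity) hlt).comp
      (tendsto_add_atTop_nat 1)).mul_const M
  exact norm_le_zero_iff.1 (ge_of_tendsto' hlim hbound)

/-- The identity theorem for the solutions of `∑ j, Aⱼ ∂ⱼ h = 0`. -/
theorem IsMonogenicOn.eqOn_zero (hA : IsCliffordPair A A') (hU : IsOpen U)
    (hUc : IsPreconnected U) (hh : IsMonogenicOn A b U h) {y : V} (hy : y ∈ U)
    (h0 : ∀ v k, (dirDeriv v)^[k] h y = 0) : EqOn h 0 U := by
  -- The set on the right is open. It is relatively closed in `U`, because vanishing of all iterated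
  -- derivatives passes to limit points by continuity.
  have hsub : U ⊆ {x | h =ᶠ[𝓝 x] 0} := by
    refine hUc.subset_of_closure_inter_subset isOpen_setOfPred_eventually_nhds
      ⟨y, hy, hh.eventuallyEq_zero hA hU hy h0⟩ ?_
    rintro x ⟨hx, hxU⟩
    refine hh.eventuallyEq_zero hA hU hxU fun v k => ?_
    have hc : ContinuousAt ((dirDeriv v)^[k] h) x :=
      ((hh.dirDeriv_iterate hA hU v k).1.contDiffAt (hU.mem_nhds hxU)).continuousAt
    have := hc.continuousWithinAt.mem_closure (t := {0}) hx
      fun z hz => (dirDeriv_iterate_eventuallyEq_zero hz v k).eq_of_nhds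
    simpa using this
  exact fun x hx => (hsub hx).eq_of_nhds

/-- A solution of `∑ j, Aⱼ ∂ⱼ h = 0` that vanishes on a coordinate hyperplane vanishes to first
order there. -/
theorem IsMonogenicOn.fderiv_eq_zero_of_hyperplane {ι V E : Type*} [Fintype ι]
    [NormedAddCommGroup V] [InnerProductSpace ℝ V] [NormedAddCommGroup E] [NormedSpace ℝ E]
    [DecidableEq ι] {A A' : ι → E →L[ℝ] E} {b : OrthonormalBasis ι ℝ V} {U : Set V} {h : V → E}
    (hA : IsCliffordPair A A') (hU : IsOpen U)
    (hh : IsMonogenicOn A b U h) {j₀ : ι} (h0 : ∀ z ∈ U, ⟪b j₀, z⟫_ℝ = 0 → h z = 0) {z : V}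
    (hz : z ∈ U) (hz0 : ⟪b j₀, z⟫_ℝ = 0) : fderiv ℝ h z = 0 := by
  have hd : DifferentiableAt ℝ h z := (hh.1.contDiffAt (hU.mem_nhds hz)).differentiableAt one_ne_zero
  have htan : ∀ j, j ≠ j₀ → fderiv ℝ h z (b j) = 0 := by
    intro j hj
    have h1 : HasDerivAt (fun s : ℝ => z + s • b j) (b j) 0 := by
      simpa using ((hasDerivAt_id (0 : ℝ)).smul_const (b j)).const_add z
    have h2 : HasDerivAt (fun s : ℝ => h (z + s • b j)) (fderiv ℝ h z (b j)) 0 := by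
      have hd' : HasFDerivAt h (fderiv ℝ h z) (z + (0 : ℝ) • b j) := by simpa using hd.hasFDerivAt
      exact hd'.comp_hasDerivAt 0 h1
    have h3 : (fun s : ℝ => h (z + s • b j)) =ᶠ[𝓝 0] fun _ => 0 := by
      have : ∀ᶠ s : ℝ in 𝓝 0, z + s • b j ∈ U :=
        h1.continuousAt.eventually_mem (by simpa using hU.mem_nhds hz)
      filter_upwards [this] with s hs
      refine h0 _ hs ?_
      rw [inner_add_right, inner_smul_right, hz0, b.inner_eq_zero hj.symm]
      simp
    exact h2.unique ((hasDerivAt_const (0 : ℝ) (0 : E)).congr_of_eventuallyEq h3)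
  -- Only the normal term of the equation survives, and `A j₀` is injective since `A' j₀` is a left
  -- inverse.
  have hnor : fderiv ℝ h z (b j₀) = 0 := by
    have h1 : A j₀ (fderiv ℝ h z (b j₀)) = 0 := by
      rw [← hh.2 z hz, Finset.sum_eq_single j₀ (fun j _ hj => by rw [htan j hj, map_zero])
        (fun h => absurd (Finset.mem_univ _) h)]
    have h2 := hA j₀ j₀ (fderiv ℝ h z (b j₀))
    rw [h1, map_zero, add_zero, if_pos rfl] at h2
    exact (smul_eq_zero.1 h2.symm).resolve_left two_ne_zero
  refine ContinuousLinearMap.coe_injective (b.toBasis.ext fun j => ?_)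
  rcases eq_or_ne j j₀ with rfl | hj
  · simpa using hnor
  · simpa using htan j hj

/-- A solution of `∑ j, Aⱼ ∂ⱼ h = 0` on a connected open set is determined by its values on a
coordinate hyperplane that meets this set. -/
theorem IsMonogenicOn.eqOn_zero_of_hyperplane (hA : IsCliffordPair A A') (hU : IsOpen U)
    (hUc : IsPreconnected U) (hh : IsMonogenicOn A b U h) {j₀ : ι}
    (h0 : ∀ z ∈ U, ⟪b j₀, z⟫_ℝ = 0 → h z = 0) {y : V} (hy : y ∈ U) (hy0 : ⟪b j₀, y⟫_ℝ = 0) :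
    EqOn h 0 U := by
  refine hh.eqOn_zero hA hU hUc hy fun v k => ?_
  have : ∀ k, ∀ z ∈ U, ⟪b j₀, z⟫_ℝ = 0 → (dirDeriv v)^[k] h z = 0 := by
    intro k
    induction k with
    | zero => exact h0
    | succ k ih =>
      intro z hz hz0
      rw [Function.iterate_succ_apply', dirDeriv,
        (hh.dirDeriv_iterate hA hU v k).fderiv_eq_zero_of_hyperplane hA hU ih hz hz0]
      rfl
  exact this k y hy hy0

end Identity

namespace OctSlice

/-! ### Octonion algebra -/

section Algebra

theorem mul_add' (a x y : Octonion) : a * (x + y) = a * x + a * y := by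
  ext k
  simp only [mul_apply, PiLp.add_apply, mul_add, Finset.sum_add_distrib]

theorem mul_smul' (c : ℝ) (a x : Octonion) : a * (c • x) = c • (a * x) := by
  ext k
  simp only [mul_apply, PiLp.smul_apply, smul_eq_mul, Finset.mul_sum]
  exact Finset.sum_congr rfl fun i _ => Finset.sum_congr rfl fun j _ => by ring

theorem smul_mul' (c : ℝ) (a x : Octonion) : (c • a) * x = c • (a * x) := by
  ext k
  simp only [mul_apply, PiLp.smul_apply, smul_eq_mul, Finset.mul_sum]
  exact Finset.sum_congr rfl fun i _ => Finset.sum_congr rfl fun j _ => by ring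

/-- Left multiplication as a continuous linear map. -/
noncomputable def mulLeft (a : Octonion) : Octonion →L[ℝ] Octonion :=
  LinearMap.toContinuousLinearMap
    { toFun := fun x => a * x
      map_add' := mul_add' a
      map_smul' := fun c x => mul_smul' c a x }

@[simp]
theorem mulLeft_apply (a x : Octonion) : mulLeft a x = a * x := rfl

theorem mul_explicit (x y : Octonion) : x * y = WithLp.toLp 2
    ![x 0 * y 0 - x 1 * y 1 - x 2 * y 2 - x 3 * y 3 - x 4 * y 4 - x 5 * y 5 - x 6 * y 6 - x 7 * y 7,
      x 0 * y 1 + x 1 * y 0 + x 2 * y 3 - x 3 * y 2 + x 4 * y 5 - x 5 * y 4 - x 6 * y 7 + x 7 * y 6,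
      x 0 * y 2 + x 2 * y 0 + x 3 * y 1 - x 1 * y 3 + x 4 * y 6 - x 6 * y 4 + x 5 * y 7 - x 7 * y 5,
      x 0 * y 3 + x 3 * y 0 + x 1 * y 2 - x 2 * y 1 + x 4 * y 7 - x 7 * y 4 - x 5 * y 6 + x 6 * y 5,
      x 0 * y 4 + x 4 * y 0 + x 5 * y 1 - x 1 * y 5 + x 6 * y 2 - x 2 * y 6 + x 7 * y 3 - x 3 * y 7,
      x 0 * y 5 + x 5 * y 0 + x 1 * y 4 - x 4 * y 1 + x 3 * y 6 - x 6 * y 3 - x 2 * y 7 + x 7 * y 2,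
      x 0 * y 6 + x 6 * y 0 + x 2 * y 4 - x 4 * y 2 - x 3 * y 5 + x 5 * y 3 + x 1 * y 7 - x 7 * y 1,
      x 0 * y 7 + x 7 * y 0 + x 3 * y 4 - x 4 * y 3 - x 1 * y 6 + x 6 * y 1 - x 5 * y 2 + x 2 * y 5
    ] := by
  ext k
  fin_cases k <;>
  · simp [mul_apply, Fin.sum_univ_eight, structConst, epsilon, triples]
    ring

/-- Polarised form of x̄(xa) = |x|²a. This is the only place where the multiplication table itself
is used. -/
theorem conj_mul_mul_add (x y a : Octonion) :
    conj x * (y * a) + conj y * (x * a) = (2 * inner ℝ x y) • a := by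
  rw [mul_explicit, mul_explicit y a, mul_explicit, mul_explicit x a]
  ext k
  fin_cases k <;>
  · simp [conj, PiLp.inner_apply, Fin.sum_univ_eight]
    ring

end Algebra

/-! ### The slice operator as a Clifford system -/

section Slice

variable {p : ℕ}

theorem mul_neg' (a x : Octonion) : a * (-x) = -(a * x) := (mulLeft a).map_neg x

theorem mul_sub' (a x y : Octonion) : a * (x - y) = a * x - a * y := (mulLeft a).map_sub x y

theorem mul_zero' (a : Octonion) : a * (0 : Octonion) = 0 := (mulLeft a).map_zero

theorem neg_mul' (a x : Octonion) : (-a) * x = -(a * x) := by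
  rw [← neg_one_smul ℝ a, smul_mul', neg_one_smul]

theorem unitP_eq (hp : p ≤ 6) (i : Fin (p + 1)) :
    unitP i = EuclideanSpace.single (Fin.castLE (by omega) i : Fin 8) (1 : ℝ) := by
  ext k
  by_cases h : k.val < p + 1
  · simp [unitP, incl, PiLp.single_apply, Fin.ext_iff]
    omega
  · have : k ≠ Fin.castLE (by omega) i := by
      intro e
      exact h (e ▸ i.isLt)
    simp [unitP, incl, PiLp.single_apply, this]
    omega

theorem conj_eq_neg {w : Octonion} (hw : w ∈ sphereQ p) : conj w = -w := by
  ext i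
  by_cases h : i = 0
  · subst h
    simp [conj, hw.1 0 (by simp)]
  · simp [conj, h]

theorem conj_conj (x : Octonion) : conj (conj x) = x := by
  ext i
  by_cases h : i = 0 <;> simp [conj, h]

theorem inner_unitP (hp : p ≤ 6) (i : Fin (p + 1)) (x : Octonion) :
    ⟪unitP i, x⟫_ℝ = x (Fin.castLE (by omega) i) := by
  rw [unitP_eq hp, EuclideanSpace.inner_single_left]
  simp

theorem inner_unitP_sphereQ (hp : p ≤ 6) (i : Fin (p + 1)) {w : Octonion} (hw : w ∈ sphereQ p) :
    ⟪unitP i, w⟫_ℝ = 0 := by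
  rw [inner_unitP hp]
  exact hw.1 _ (by simp; omega)

theorem sphereQ_mul_mul {w : Octonion} (hw : w ∈ sphereQ p) (a : Octonion) : w * (w * a) = -a := by
  have h := conj_mul_mul_add w w a
  rw [conj_eq_neg hw, real_inner_self_eq_norm_sq, hw.2, neg_mul'] at h
  have h2 : (2 : ℝ) • (w * (w * a) + a) = 0 := by
    rw [one_pow, mul_one] at h
    rw [smul_add, ← h, two_smul]
    abel
  exact eq_neg_of_add_eq_zero_left ((smul_eq_zero.1 h2).resolve_left two_ne_zero)

/-- The polarised identity for the orthogonal pair eᵢ, ω, with ω̄ = -ω. The companion rule below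
uses ēᵢ instead of eᵢ. -/
theorem conj_unitP_mul_mul (hp : p ≤ 6) (i : Fin (p + 1)) {w : Octonion} (hw : w ∈ sphereQ p)
    (a : Octonion) : conj (unitP i) * (w * a) = w * (unitP i * a) := by
  have h := conj_mul_mul_add (unitP i) w a
  rw [inner_unitP_sphereQ hp i hw, conj_eq_neg hw, neg_mul', mul_zero, zero_smul] at h
  exact add_neg_eq_zero.1 h

theorem unitP_mul_mul (hp : p ≤ 6) (i : Fin (p + 1)) {w : Octonion} (hw : w ∈ sphereQ p)
    (a : Octonion) : unitP i * (w * a) = w * (conj (unitP i) * a) := by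
  have h0 : ⟪conj (unitP i), w⟫_ℝ = 0 := by
    have h1 : ⟪conj (unitP i), w⟫_ℝ = -⟪unitP i, w⟫_ℝ := by
      have hw0 : w 0 = 0 := hw.1 0 (by simp)
      simp [PiLp.inner_apply, Fin.sum_univ_eight, conj, hw0]
      ring
    rw [h1, inner_unitP_sphereQ hp i hw, neg_zero]
  have h := conj_mul_mul_add (conj (unitP i)) w a
  rw [h0, conj_conj, conj_eq_neg hw, neg_mul', mul_zero, zero_smul] at h
  exact add_neg_eq_zero.1 h

/-- The vectors e₀, …, e_p, ω are orthonormal, so the polarised identity is exactly the Clifford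
relation. It concerns operators, so non-associativity does no harm. -/
theorem isCliffordPair_slice (hp : p ≤ 6) {w : Octonion} (hw : w ∈ sphereQ p) :
    IsCliffordPair (fun j : Fin (p + 1) ⊕ Unit => mulLeft (Sum.elim unitP (fun _ => w) j))
      (fun j => mulLeft (conj (Sum.elim unitP (fun _ => w) j))) := by
  intro j k a
  simp only [mulLeft_apply, conj_mul_mul_add]
  have : ⟪Sum.elim unitP (fun _ => w) k, Sum.elim unitP (fun _ => w) j⟫_ℝ =
      if j = k then (1 : ℝ) else 0 := by
    rcases j with j | j <;> rcases k with k | k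
    · simp only [Sum.elim_inl]
      rw [inner_unitP hp, unitP_eq hp]
      by_cases h : j = k
      · simp [h]
      · have h' : k ≠ j := fun e => h e.symm
        simp [h, h']
    · simp only [Sum.elim_inl, Sum.elim_inr]
      rw [real_inner_comm, inner_unitP_sphereQ hp j hw]
      simp
    · simp only [Sum.elim_inl, Sum.elim_inr]
      rw [inner_unitP_sphereQ hp k hw]
      simp
    · simp only [Sum.elim_inr]
      rw [real_inner_self_eq_norm_sq, hw.2]
      simp
  rw [this]
  split_ifs <;> simp

/-- A partial-slice monogenic function on a connected slice is determined by its values on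
`ℝ^{p+1}`. -/
theorem eqOn_zero_of_slice (hp : p ≤ 6) {w : Octonion} (hw : w ∈ sphereQ p) {D : Set (Para p)}
    (hD : IsOpen D) (hDc : IsPreconnected D) {h : Para p → Octonion} (hh : ContDiffOn ℝ 1 h D)
    (hm : ∀ z ∈ D, DP h z + w * dr h z = 0) (h0 : ∀ x, (x, (0 : ℝ)) ∈ D → h (x, 0) = 0)
    {x₀ : EuclideanSpace ℝ (Fin (p + 1))} (hx₀ : (x₀, (0 : ℝ)) ∈ D) : EqOn h 0 D := by
  -- `Para p` carries the sup norm; the general theory needs its Euclidean version.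
  let e : WithLp 2 (EuclideanSpace ℝ (Fin (p + 1)) × ℝ) ≃L[ℝ] Para p :=
    WithLp.prodContinuousLinearEquiv 2 ℝ _ _
  let b : OrthonormalBasis (Fin (p + 1) ⊕ Unit) ℝ (WithLp 2 (EuclideanSpace ℝ (Fin (p + 1)) × ℝ)) :=
    (EuclideanSpace.basisFun (Fin (p + 1)) ℝ).prod (OrthonormalBasis.singleton Unit ℝ)
  have hbl : ∀ i, e (b (Sum.inl i)) = (EuclideanSpace.single i 1, 0) := fun i => by
    simp [e, b, OrthonormalBasis.prod_apply]
  have hbr : ∀ i, e (b (Sum.inr i)) = (0, 1) := fun i => by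
    simp [e, b, OrthonormalBasis.prod_apply]
  have hmon : IsMonogenicOn (fun j : Fin (p + 1) ⊕ Unit => mulLeft (Sum.elim unitP (fun _ => w) j))
      b (e ⁻¹' D) (h ∘ e) := by
    refine ⟨hh.comp e.contDiff.contDiffOn (mapsTo_preimage e D), fun z hz => ?_⟩
    rw [e.comp_right_fderiv, Fintype.sum_sum_type]
    simp only [ContinuousLinearMap.comp_apply, ContinuousLinearEquiv.coe_coe, hbl, hbr]
    simpa [DP, dx, dr] using hm (e z) hz
  have hin : ∀ z, ⟪b (Sum.inr ()), z⟫_ℝ = (e z).2 := fun z => by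
    simp [e, b, OrthonormalBasis.prod_apply, WithLp.prod_inner_apply]
  have hpre : IsPreconnected (e ⁻¹' D) := by
    rw [← e.image_symm_eq_preimage]
    exact hDc.image _ e.symm.continuous.continuousOn
  have hE := hmon.eqOn_zero_of_hyperplane (isCliffordPair_slice hp hw)
    (hD.preimage e.continuous) hpre (j₀ := Sum.inr ()) (y := e.symm (x₀, 0))
    (fun z hz hz0 => by
      rw [hin] at hz0
      have hz' : e z = ((e z).1, 0) := Prod.ext rfl hz0
      change h (e z) = 0
      rw [hz']
      exact h0 _ (hz' ▸ hz)) (by simpa using hx₀) (by rw [hin]; simp)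
  intro z hz
  have := hE (x := e.symm z) (by simpa using hz)
  simpa using this

end Slice

/-! ### Slices of the completion and the representation by stem functions -/

section Main

variable {p : ℕ} {D : Set (Para p)}

theorem single_mem_sphereQ {i : Fin 8} (hi : p < i.val) :
    EuclideanSpace.single i (1 : ℝ) ∈ sphereQ p := by
  refine ⟨fun j hj => ?_, by simp⟩
  have : j ≠ i := by
    rintro rfl
    omega
  simp [this]

theorem neg_mem_sphereQ {w : Octonion} (hw : w ∈ sphereQ p) : -w ∈ sphereQ p :=
  ⟨fun i hi => by simp [hw.1 i hi], by rw [norm_neg]; exact hw.2⟩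

theorem slicePt_neg (w : Octonion) (x : EuclideanSpace ℝ (Fin (p + 1))) (r : ℝ) :
    slicePt p (-w) (x, -r) = slicePt p w (x, r) := by
  simp [slicePt]

theorem slicePt_zero (w : Octonion) (x : EuclideanSpace ℝ (Fin (p + 1))) :
    slicePt p w (x, 0) = incl p x := by
  simp [slicePt]

theorem slicePt_mem_completion (hD : IsReflInvariant D) {w : Octonion} (hw : w ∈ sphereQ p)
    {z : Para p} (hz : z ∈ D) : slicePt p w z ∈ completion p D := by
  rcases le_total 0 z.2 with h | h
  · exact ⟨w, hw, z.1, z.2, h, hz, rfl⟩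
  · exact ⟨-w, neg_mem_sphereQ hw, z.1, -z.2, by linarith, hD _ _ hz, (slicePt_neg w _ _).symm⟩

theorem norm_projQ_slicePt {w : Octonion} (hw : w ∈ sphereQ p) (z : Para p) :
    ‖projQ p (slicePt p w z)‖ = |z.2| := by
  rw [projQ_slicePt hw, norm_smul, hw.2, mul_one, Real.norm_eq_abs]

/-- A point determines x_p and |r|, and reflection invariance makes the sign of r irrelevant. Hence
every slice of Ω_D is all of `D`. -/
theorem slicePt_mem_completion_iff (hp : p ≤ 6) (hD : IsReflInvariant D) {w : Octonion}
    (hw : w ∈ sphereQ p) {z : Para p} : slicePt p w z ∈ completion p D ↔ z ∈ D := by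
  refine ⟨?_, slicePt_mem_completion hD hw⟩
  rintro ⟨w', hw', x, r, hr, hz, h⟩
  have h1 : z.1 = x := by
    rw [← projP_slicePt hp hw z, h, projP_slicePt hp hw']
  have h2 : |z.2| = r := by
    rw [← norm_projQ_slicePt hw z, h, norm_projQ_slicePt hw', abs_of_nonneg hr]
  obtain ⟨a, s⟩ := z
  simp only at h1 h2
  subst h1 h2
  rcases abs_choice s with h | h
  · rwa [h] at hz
  · rw [h] at hz
    simpa using hD _ _ hz

theorem sliceSet_completion (hp : p ≤ 6) (hD : IsReflInvariant D) {w : Octonion}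
    (hw : w ∈ sphereQ p) : sliceSet p (completion p D) w = D :=
  Set.ext fun _ => slicePt_mem_completion_iff hp hD hw

theorem sliceFun_eq {U : Set Octonion} (f : U → Octonion) {w : Octonion} {z : Para p}
    (hz : slicePt p w z ∈ U) : sliceFun p f w z = f ⟨slicePt p w z, hz⟩ := by
  rw [sliceFun, dif_pos hz]

theorem sliceFun_congr {U : Set Octonion} (f : U → Octonion) {w w' : Octonion} {z z' : Para p}
    (h : slicePt p w z = slicePt p w' z') : sliceFun p f w z = sliceFun p f w' z' := by
  unfold sliceFun
  congr! 3

theorem sliceFun_induced (hp : p ≤ 6) (hD : IsReflInvariant D) {F : Para p → Octonion × Octonion}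
    (hF : IsStem D F) {w : Octonion} (hw : w ∈ sphereQ p) {z : Para p} (hz : z ∈ D) :
    sliceFun p (induced p D F) w z = (F z).1 + w * (F z).2 := by
  obtain ⟨x, r⟩ := z
  rcases le_total 0 r with h | h
  · rw [sliceFun_eq _ (slicePt_mem_completion hD hw hz), induced_slicePt hp hF hw h hz]
  · have hz' := hD _ _ hz
    rw [sliceFun_congr _ (slicePt_neg w x r).symm,
      sliceFun_eq _ (slicePt_mem_completion hD (neg_mem_sphereQ hw) hz'),
      induced_slicePt hp hF (neg_mem_sphereQ hw) (by linarith) hz', (hF x r hz).1, (hF x r hz).2,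
      neg_mul', mul_neg', neg_neg]

/-- Moving ω to the left conjugates the eᵢ, so the slice operator splits into the first
Cauchy–Riemann expression plus ω times the second. -/
theorem slice_operator_eq_zero (hp : p ≤ 6) {w : Octonion} (hw : w ∈ sphereQ p)
    {F₁ F₂ : Para p → Octonion} {z : Para p} (h₁ : DifferentiableAt ℝ F₁ z)
    (h₂ : DifferentiableAt ℝ F₂ z) (hcr₁ : DP F₁ z - dr F₂ z = 0)
    (hcr₂ : DPbar F₂ z + dr F₁ z = 0) :
    DP (fun u => F₁ u + w * F₂ u) z + w * dr (fun u => F₁ u + w * F₂ u) z = 0 := by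
  have hd : HasFDerivAt (fun u => F₁ u + w * F₂ u)
      (fderiv ℝ F₁ z + (mulLeft w).comp (fderiv ℝ F₂ z)) z :=
    h₁.hasFDerivAt.add ((mulLeft w).hasFDerivAt.comp z h₂.hasFDerivAt)
  have h1 : DP (fun u => F₁ u + w * F₂ u) z = DP F₁ z + w * DPbar F₂ z := by
    simp only [DP, DPbar, dx, hd.fderiv, _root_.add_apply,
      ContinuousLinearMap.comp_apply, mulLeft_apply, mul_add', Finset.sum_add_distrib,
      unitP_mul_mul hp _ hw]
    congr 1
    simp only [← mulLeft_apply w, ← map_sum]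
  have h2 : dr (fun u => F₁ u + w * F₂ u) z = dr F₁ z + w * dr F₂ z := by
    simp only [dr, hd.fderiv, _root_.add_apply,
      ContinuousLinearMap.comp_apply, mulLeft_apply]
  rw [h1, h2, mul_add', sphereQ_mul_mul hw]
  calc DP F₁ z + w * DPbar F₂ z + (w * dr F₁ z + -dr F₂ z)
      = (DP F₁ z - dr F₂ z) + w * (DPbar F₂ z + dr F₁ z) := by rw [mul_add']; abel
    _ = 0 := by rw [hcr₁, hcr₂, mul_zero', add_zero]

theorem slice_operator_congr {w : Octonion} {f g : Para p → Octonion} {z : Para p}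
    (h : f =ᶠ[𝓝 z] g) : DP f z + w * dr f z = DP g z + w * dr g z := by
  simp only [DP, dx, dr, h.fderiv_eq]

theorem contDiffOn_mulLeft (w : Octonion) {f : Para p → Octonion} (hf : ContDiffOn ℝ 1 f D) :
    ContDiffOn ℝ 1 (fun z => w * f z) D :=
  (mulLeft w).contDiff.comp_contDiffOn hf

/-- Generalized partial-slice regular functions are generalized partial-slice monogenic. -/
theorem GSR_subset_GSM (hp : p ≤ 6) (hDo : IsOpen D) (hD : IsReflInvariant D) :
    GSR p D ⊆ GSM p (completion p D) := by
  rintro f ⟨F, hF, hFc, hcr, rfl⟩ w hw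
  rw [sliceSet_completion hp hD hw]
  have heq : EqOn (sliceFun p (induced p D F) w) (fun z => (F z).1 + w * (F z).2) D :=
    fun z hz => sliceFun_induced hp hD hF hw hz
  have h₁ : ContDiffOn ℝ 1 (fun z => (F z).1) D := hFc.fst
  have h₂ : ContDiffOn ℝ 1 (fun z => (F z).2) D := hFc.snd
  refine ⟨(h₁.add (contDiffOn_mulLeft w h₂)).congr heq, fun z hz => ?_⟩
  rw [slice_operator_congr (heq.eventuallyEq_of_mem (hDo.mem_nhds hz))]
  exact slice_operator_eq_zero hp hw
    ((h₁.contDiffAt (hDo.mem_nhds hz)).differentiableAt one_ne_zero)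
    ((h₂.contDiffAt (hDo.mem_nhds hz)).differentiableAt one_ne_zero) (hcr z hz).1 (hcr z hz).2

/-- The reflection `(x_p, r) ↦ (x_p, -r)`. -/
noncomputable def reflection (p : ℕ) : Para p →L[ℝ] Para p :=
  (ContinuousLinearMap.fst ℝ _ _).prod (-ContinuousLinearMap.snd ℝ _ _)

@[simp]
theorem reflection_apply (x : EuclideanSpace ℝ (Fin (p + 1))) (r : ℝ) :
    reflection p (x, r) = (x, -r) := rfl

theorem mapsTo_reflection (hD : IsReflInvariant D) : MapsTo (reflection p) D D :=
  fun _ hz => hD _ _ hz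

/-- The stem function recovered from the restriction `g` of a function to one slice. -/
noncomputable def stemOf (η : Octonion) (g : Para p → Octonion) (z : Para p) : Octonion × Octonion :=
  ((1 / 2 : ℝ) • (g z + g (reflection p z)), (1 / 2 : ℝ) • (η * (g (reflection p z) - g z)))

theorem isStem_stemOf (η : Octonion) (g : Para p → Octonion) : IsStem D (stemOf η g) := by
  refine fun x r _ => ⟨?_, ?_⟩
  · simp [stemOf, add_comm]
  · simp only [stemOf, reflection_apply, neg_neg]
    rw [← smul_neg, ← mul_neg', neg_sub]

theorem contDiffOn_stemOf (hD : IsReflInvariant D) (η : Octonion) {g : Para p → Octonion}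
    (hg : ContDiffOn ℝ 1 g D) : ContDiffOn ℝ 1 (stemOf η g) D := by
  have h1 : ContDiffOn ℝ 1 (fun z => g (reflection p z)) D :=
    hg.comp (reflection p).contDiff.contDiffOn (mapsTo_reflection hD)
  exact ((hg.add h1).const_smul (1 / 2 : ℝ)).prodMk
    ((contDiffOn_mulLeft η (h1.sub hg)).const_smul (1 / 2 : ℝ))

/-- Combine the slice equation at `z` and at its reflection, where ∂ᵣ of the reflected function
changes sign; moving η past ēᵢ turns D̄ into D. -/
theorem stemOf_cauchyRiemann (hp : p ≤ 6) (hDo : IsOpen D) (hD : IsReflInvariant D)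
    {η : Octonion} (hη : η ∈ sphereQ p) {g : Para p → Octonion} (hg : ContDiffOn ℝ 1 g D)
    (hm : ∀ z ∈ D, DP g z + η * dr g z = 0) {z : Para p} (hz : z ∈ D) :
    DP (fun u => (stemOf η g u).1) z - dr (fun u => (stemOf η g u).2) z = 0 ∧
      DPbar (fun u => (stemOf η g u).2) z + dr (fun u => (stemOf η g u).1) z = 0 := by
  have hz' := mapsTo_reflection hD hz
  have hd : HasFDerivAt g (fderiv ℝ g z) z :=
    ((hg.contDiffAt (hDo.mem_nhds hz)).differentiableAt one_ne_zero).hasFDerivAt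
  have hd' : HasFDerivAt (fun z => g (reflection p z))
      ((fderiv ℝ g (reflection p z)).comp (reflection p)) z :=
    ((hg.contDiffAt (hDo.mem_nhds hz')).differentiableAt one_ne_zero).hasFDerivAt.comp z
      (reflection p).hasFDerivAt
  have h1 : HasFDerivAt (fun u => (stemOf η g u).1) _ z := (hd.add hd').const_smul (1 / 2 : ℝ)
  have h2 : HasFDerivAt (fun u => (stemOf η g u).2) _ z :=
    ((mulLeft η).hasFDerivAt.comp z (hd'.sub hd)).const_smul (1 / 2 : ℝ)
  have e0 : ((0 : EuclideanSpace ℝ (Fin (p + 1))), (-1 : ℝ)) = -(0, 1) := by simp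
  have hdx1 : ∀ i, dx i (fun u => (stemOf η g u).1) z =
      (1 / 2 : ℝ) • (dx i g z + dx i g (reflection p z)) := fun i => by
    simp [dx, h1.fderiv]
  have hdx2 : ∀ i, dx i (fun u => (stemOf η g u).2) z =
      (1 / 2 : ℝ) • (η * (dx i g (reflection p z) - dx i g z)) := fun i => by
    simp [dx, h2.fderiv, mul_sub']
  have hdr1 : dr (fun u => (stemOf η g u).1) z =
      (1 / 2 : ℝ) • (dr g z - dr g (reflection p z)) := by
    simp [dr, h1.fderiv, e0, sub_eq_add_neg, -Prod.neg_mk]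
  have hdr2 : dr (fun u => (stemOf η g u).2) z =
      -((1 / 2 : ℝ) • (η * dr g z + η * dr g (reflection p z))) := by
    rw [dr, h2.fderiv]
    simp only [_root_.smul_apply, ContinuousLinearMap.comp_apply, _root_.sub_apply,
      mulLeft_apply, reflection_apply, e0, map_neg]
    change (1 / 2 : ℝ) • (η * (-dr g (reflection p z) - dr g z)) = _
    rw [mul_sub', mul_neg', ← smul_neg]
    congr 1
    abel
  have hDP1 : DP (fun u => (stemOf η g u).1) z =
      (1 / 2 : ℝ) • (DP g z + DP g (reflection p z)) := by
    simp only [DP, hdx1, mul_smul', mul_add', ← Finset.smul_sum, Finset.sum_add_distrib]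
  have hDP2 : DPbar (fun u => (stemOf η g u).2) z =
      (1 / 2 : ℝ) • (η * (DP g (reflection p z) - DP g z)) := by
    simp only [DPbar, DP, hdx2, mul_smul', conj_unitP_mul_mul hp _ hη, ← Finset.smul_sum,
      ← Finset.sum_sub_distrib, ← mul_sub']
    congr 1
    simp only [← mulLeft_apply η, ← map_sum]
  have hm1 : DP g z = -(η * dr g z) := eq_neg_of_add_eq_zero_left (hm z hz)
  have hm2 : DP g (reflection p z) = -(η * dr g (reflection p z)) :=
    eq_neg_of_add_eq_zero_left (hm _ hz')
  constructor
  · rw [hDP1, hdr2, hm1, hm2, sub_neg_eq_add, ← smul_add, smul_eq_zero]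
    right
    abel
  · rw [hDP2, hdr1, hm1, hm2, ← smul_add, mul_sub', mul_neg', mul_neg', sphereQ_mul_mul hη,
      sphereQ_mul_mul hη, smul_eq_zero]
    right
    abel

theorem continuous_projP : Continuous (projP p) := by
  refine (PiLp.continuous_toLp 2 _).comp (continuous_pi fun i => ?_)
  split_ifs with h
  · fun_prop
  · exact continuous_const

theorem continuous_projQ : Continuous (projQ p) := by
  refine (PiLp.continuous_toLp 2 _).comp (continuous_pi fun i => ?_)
  split_ifs with h
  · exact continuous_const
  · fun_prop

/-- If the completion of `D` is connected and meets `ℝ^{p+1}`, then `D` is connected. -/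
theorem isPreconnected_of_completion (hp : p ≤ 6) (hD : IsReflInvariant D)
    (hc : IsPreconnected (completion p D)) {x : EuclideanSpace ℝ (Fin (p + 1))}
    (hx : (x, (0 : ℝ)) ∈ D) : IsPreconnected D := by
  have hη : EuclideanSpace.single 7 (1 : ℝ) ∈ sphereQ p := single_mem_sphereQ (by simp; omega)
  -- The upper half of `D` is a continuous image of Ω_D; it is glued to its mirror image at the
  -- common point `(x, 0)`.
  have himage : (fun y => (projP p y, ‖projQ p y‖)) '' completion p D = D ∩ {z | 0 ≤ z.2} := by
    ext z
    constructor
    · rintro ⟨_, ⟨w, hw, x, r, hr, hz, rfl⟩, rfl⟩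
      simp only [projP_slicePt hp hw, norm_projQ_slicePt hw, abs_of_nonneg hr]
      exact ⟨hz, hr⟩
    · rintro ⟨hz, hr⟩
      refine ⟨_, slicePt_mem_completion hD hη hz, ?_⟩
      simp only [projP_slicePt hp hη, norm_projQ_slicePt hη]
      rw [abs_of_nonneg hr]
  have h1 : IsPreconnected (D ∩ {z | 0 ≤ z.2}) := by
    rw [← himage]
    exact hc.image _ (continuous_projP.prodMk continuous_projQ.norm).continuousOn
  have h2 := h1.image _ (reflection p).continuous.continuousOn
  have hun : D = (D ∩ {z | 0 ≤ z.2}) ∪ reflection p '' (D ∩ {z | 0 ≤ z.2}) := by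
    ext ⟨a, r⟩
    constructor
    · intro hz
      rcases le_total 0 r with h | h
      · exact Or.inl ⟨hz, h⟩
      · exact Or.inr ⟨(a, -r), ⟨hD _ _ hz, by simpa using h⟩, by simp⟩
    · rintro (h | ⟨z, hz, h⟩)
      · exact h.1
      · exact h ▸ mapsTo_reflection hD hz.1
  rw [hun]
  exact IsPreconnected.union (x, 0) ⟨hx, by simp⟩ ⟨(x, 0), ⟨hx, by simp⟩, by simp⟩ h1 h2

/-- Generalized partial-slice monogenic functions on a domain that meets `ℝ^{p+1}` are generalized
partial-slice regular. -/
theorem GSM_subset_GSR (hp : p ≤ 6) (hDo : IsOpen D) (hD : IsReflInvariant D)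
    (hc : IsPreconnected (completion p D)) {x₀ : EuclideanSpace ℝ (Fin (p + 1))}
    (hx₀ : (x₀, (0 : ℝ)) ∈ D) : GSM p (completion p D) ⊆ GSR p D := by
  intro f hf
  have hη : EuclideanSpace.single 7 (1 : ℝ) ∈ sphereQ p := single_mem_sphereQ (by simp; omega)
  set η : Octonion := EuclideanSpace.single 7 (1 : ℝ)
  have hfη := hf η hη
  rw [sliceSet_completion hp hD hη] at hfη
  set g := sliceFun p f η with hg
  have hcr := fun z (hz : z ∈ D) => stemOf_cauchyRiemann hp hDo hD hη hfη.1 hfη.2 hz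
  have hF := contDiffOn_stemOf hD η hfη.1
  have h₁ : ContDiffOn ℝ 1 (fun z => (stemOf η g z).1) D := hF.fst
  have h₂ : ContDiffOn ℝ 1 (fun z => (stemOf η g z).2) D := hF.snd
  refine ⟨stemOf η g, isStem_stemOf η g, hF, hcr, ?_⟩
  funext ⟨y, hy⟩
  obtain ⟨w, hw, x, r, hr, hz, rfl⟩ := id hy
  rw [induced_slicePt hp (isStem_stemOf η g) hw hr hz, ← sliceFun_eq f hy]
  have hfw := hf w hw
  rw [sliceSet_completion hp hD hw] at hfw
  have hGc : ContDiffOn ℝ 1 (fun z => (stemOf η g z).1 + w * (stemOf η g z).2) D :=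
    h₁.add (contDiffOn_mulLeft w h₂)
  have hzero : EqOn (fun z => sliceFun p f w z - ((stemOf η g z).1 + w * (stemOf η g z).2)) 0 D := by
    refine eqOn_zero_of_slice hp hw hDo (isPreconnected_of_completion hp hD hc hx₀)
      (hfw.1.sub hGc) (fun z hz => ?_) (fun x hx => ?_) hx₀
    · have hdf := (hfw.1.contDiffAt (hDo.mem_nhds hz)).differentiableAt one_ne_zero
      have hdG := (hGc.contDiffAt (hDo.mem_nhds hz)).differentiableAt one_ne_zero
      have hG0 := slice_operator_eq_zero hp hw
        ((h₁.contDiffAt (hDo.mem_nhds hz)).differentiableAt one_ne_zero)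
        ((h₂.contDiffAt (hDo.mem_nhds hz)).differentiableAt one_ne_zero) (hcr z hz).1 (hcr z hz).2
      calc _ = (DP (sliceFun p f w) z + w * dr (sliceFun p f w) z) -
            (DP (fun u => (stemOf η g u).1 + w * (stemOf η g u).2) z +
              w * dr (fun u => (stemOf η g u).1 + w * (stemOf η g u).2) z) := by
            simp only [DP, dx, dr, fderiv_fun_sub hdf hdG, _root_.sub_apply, mul_sub',
              Finset.sum_sub_distrib]
            abel
        _ = 0 := by rw [hfw.2 z hz, hG0, sub_zero]
    -- All slices share the points of ℝ^{p+1}, and there the stem function is `(g, 0)`.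
    · have h0 : sliceFun p f w (x, 0) = g (x, 0) :=
        sliceFun_congr f (by rw [slicePt_zero, slicePt_zero])
      simp only [h0, stemOf, reflection_apply, neg_zero, sub_self, mul_zero', smul_zero, add_zero]
      rw [← two_smul ℝ, smul_smul]
      norm_num
  exact sub_eq_zero.1 (hzero hz)

/-! ### The half-slice counterexample -/

open Classical in
/-- The indicator function of the open half-slice `{x_p + r v : r > 0}`. -/
noncomputable def halfSliceIndicator (U : Set Octonion) (p : ℕ) (v : Octonion) : U → Octonion :=
  fun y => if ∃ s : ℝ, 0 < s ∧ projQ p (y : Octonion) = s • v then EuclideanSpace.single 0 1 else 0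

/-- For fixed ω, lying in the half-slice depends only on the sign of r, which is locally constant on
`D`. So every restriction is locally constant. -/
theorem halfSliceIndicator_mem_GSM (hp : p ≤ 6) (hDo : IsOpen D) (hD : IsReflInvariant D)
    (h0 : ∀ z ∈ D, z.2 ≠ 0) (v : Octonion) :
    halfSliceIndicator (completion p D) p v ∈ GSM p (completion p D) := by
  intro w hw
  rw [sliceSet_completion hp hD hw]
  have hscale : ∀ r c : ℝ, 0 < c → (∃ s : ℝ, 0 < s ∧ r • w = s • v) →
      ∃ s : ℝ, 0 < s ∧ (c * r) • w = s • v := by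
    rintro r c hc ⟨s, hs, h⟩
    exact ⟨c * s, mul_pos hc hs, by rw [mul_smul, h, mul_smul]⟩
  have hloc : ∀ z ∈ D, sliceFun p (halfSliceIndicator (completion p D) p v) w =ᶠ[𝓝 z]
      fun _ => sliceFun p (halfSliceIndicator (completion p D) p v) w z := by
    intro z hz
    have hquot : ∀ᶠ z' in 𝓝 z, 0 < z'.2 / z.2 := by
      have hc : ContinuousAt (fun z' : Para p => z'.2 / z.2) z :=
        (continuous_snd.div_const _).continuousAt
      exact hc.eventually (lt_mem_nhds (by simp [h0 z hz]))
    filter_upwards [hquot, hDo.mem_nhds hz] with z' hz' hz'D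
    rw [sliceFun_eq _ (slicePt_mem_completion hD hw hz'D),
      sliceFun_eq _ (slicePt_mem_completion hD hw hz)]
    unfold halfSliceIndicator
    congr! 1
    simp only [projQ_slicePt hw]
    refine ⟨fun h => ?_, fun h => ?_⟩
    · have := hscale _ _ (inv_pos.2 hz') h
      rwa [inv_div, div_mul_cancel₀ _ (h0 z' hz'D)] at this
    · have := hscale _ _ hz' h
      rwa [div_mul_cancel₀ _ (h0 z hz)] at this
  refine ⟨fun z hz => (contDiffAt_const.congr_of_eventuallyEq (hloc z hz)).contDiffWithinAt,
    fun z hz => ?_⟩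
  rw [slice_operator_congr (hloc z hz)]
  simp [DP, dx, dr, mul_zero']

/-- Zeros at e₆ and -e₆ force F₁ = 0, and the zero at -e₇ then forces e₇F₂ = 0. This contradicts the
value 1 at e₇. The bound on p puts e₆ in 𝕊. -/
theorem halfSliceIndicator_notMem_GSR (hp : p ≤ 5) (hD : IsReflInvariant D)
    {x : EuclideanSpace ℝ (Fin (p + 1))} {r : ℝ} (hr : 0 < r) (hz : (x, r) ∈ D) :
    halfSliceIndicator (completion p D) p (EuclideanSpace.single 7 1) ∉ GSR p D := by
  rintro ⟨F, hF, -, -, hfF⟩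
  have h7 : EuclideanSpace.single 7 (1 : ℝ) ∈ sphereQ p := single_mem_sphereQ (by simp; omega)
  have h6 : EuclideanSpace.single 6 (1 : ℝ) ∈ sphereQ p := single_mem_sphereQ (by simp; omega)
  have hval : ∀ w (hw : w ∈ sphereQ p), (F (x, r)).1 + w * (F (x, r)).2 =
      halfSliceIndicator (completion p D) p (EuclideanSpace.single 7 1) ⟨slicePt p w (x, r),
        slicePt_mem_completion hD hw hz⟩ := by
    intro w hw
    rw [hfF, induced_slicePt (by omega) hF hw hr.le hz]
  have hzero : ∀ w ∈ sphereQ p, w 7 ≤ 0 → (F (x, r)).1 + w * (F (x, r)).2 = 0 := by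
    intro w hw hw7
    rw [hval w hw, halfSliceIndicator, if_neg]
    rintro ⟨s, hs, h⟩
    rw [projQ_slicePt hw] at h
    have := congrArg (fun v : Octonion => v 7) h
    simp at this
    nlinarith
  have e1 := hzero _ h6 (by simp)
  have e2 := hzero _ (neg_mem_sphereQ h6) (by simp)
  have e3 := hzero _ (neg_mem_sphereQ h7) (by simp)
  have e4 := hval _ h7
  rw [halfSliceIndicator, if_pos ⟨r, hr, by rw [projQ_slicePt h7]⟩] at e4
  rw [neg_mul'] at e2 e3
  have e5 : (EuclideanSpace.single 0 (1 : ℝ) : Octonion) = 0 := by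
    have h1 : (F (x, r)).1 = 0 := by
      have h2 : (2 : ℝ) • (F (x, r)).1 = 0 := by
        rw [two_smul, ← add_zero (0 : Octonion)]
        nth_rewrite 2 [← e2]
        rw [← e1]
        abel
      exact (smul_eq_zero.1 h2).resolve_left two_ne_zero
    rw [h1, zero_add] at e3 e4
    rw [← e4, neg_eq_zero.1 e3]
  simpa using congrArg (fun v : Octonion => v 0) e5

/-- For `p = 6` a connected completion meets `ℝ^{p+1}`. -/
theorem exists_mem_of_isPreconnected_completion_six {D : Set (Para 6)} (hD : IsReflInvariant D)
    (hc : IsPreconnected (completion 6 D)) (hne : D.Nonempty) : ∃ x, (x, (0 : ℝ)) ∈ D := by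
  obtain ⟨⟨x, r⟩, hz⟩ := hne
  have h7 : EuclideanSpace.single 7 (1 : ℝ) ∈ sphereQ 6 := single_mem_sphereQ (by simp)
  have hcoord : ∀ w z, slicePt 6 w z 7 = z.2 * w 7 := fun w z => by simp [slicePt, incl]
  have h1 := slicePt_mem_completion hD h7 hz
  have h2 := slicePt_mem_completion hD h7 (hD _ _ hz)
  have hcont : ContinuousOn (fun y : Octonion => y 7) (completion 6 D) := by fun_prop
  -- Here 𝕊 = {±e₇}: the last coordinate takes the values `r` and `-r`, hence also `0`, and it can
  -- vanish only where the radius does.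
  have hzero : (0 : ℝ) ∈ (fun y : Octonion => y 7) '' completion 6 D := by
    rcases le_total 0 r with h | h
    · exact hc.intermediate_value h2 h1 hcont (by simp [hcoord, h])
    · exact hc.intermediate_value h1 h2 hcont (by simp [hcoord, h])
  obtain ⟨_, ⟨w, hw, x', r', -, hz', rfl⟩, h0⟩ := hzero
  simp only [hcoord] at h0
  have hw7 : w 7 ≠ 0 := by
    intro hw7
    have : w = 0 := by
      ext i
      rcases Nat.lt_or_ge 6 i.val with h | h
      · have : i = 7 := Fin.ext (by simp; omega)
        rw [this, hw7]
        rfl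
      · exact hw.1 i h
    have h1 := hw.2
    rw [this, norm_zero] at h1
    exact zero_ne_one h1
  exact ⟨x', by rwa [(mul_eq_zero.1 h0).resolve_right hw7] at hz'⟩

end Main

end OctSlice

theorem mainTheorem7 (p : ℕ) (hp : p ≤ 6) (D : Set (OctSlice.Para p))
    (hDopen : IsOpen D) (hDrefl : OctSlice.IsReflInvariant D)
    (hopen : IsOpen (OctSlice.completion p D))
    (hconn : IsConnected (OctSlice.completion p D))
    (hsymm : OctSlice.IsPSymmetric p (OctSlice.completion p D)) :
    (OctSlice.completion p D ∩ OctSlice.realPart p = ∅ →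
      OctSlice.GSR p D ⊂ OctSlice.GSM p (OctSlice.completion p D)) ∧
    ((OctSlice.completion p D ∩ OctSlice.realPart p).Nonempty →
      OctSlice.GSM p (OctSlice.completion p D) = OctSlice.GSR p D) := by
  have h7 : EuclideanSpace.single 7 (1 : ℝ) ∈ OctSlice.sphereQ p :=
    OctSlice.single_mem_sphereQ (by simp; omega)
  have hsub := OctSlice.GSR_subset_GSM hp hDopen hDrefl
  refine ⟨fun hempty => ?_, fun ⟨y, hy, x, hx⟩ => ?_⟩
  · have h0 : ∀ x, (x, (0 : ℝ)) ∉ D := fun x hx => by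
      have h1 := OctSlice.slicePt_mem_completion hDrefl h7 hx
      rw [OctSlice.slicePt_zero] at h1
      exact Set.eq_empty_iff_forall_notMem.1 hempty _ ⟨h1, x, rfl⟩
    have h0' : ∀ z ∈ D, z.2 ≠ 0 := fun ⟨x, r⟩ hz hr => h0 x (by simp only at hr; rwa [hr] at hz)
    obtain ⟨_, w, hw, x, r, hr, hz, -⟩ := hconn.nonempty
    have hr0 : 0 < r := hr.lt_of_ne (h0' _ hz).symm
    -- The counterexample needs q ≥ 2; for p = 6 the assumption `hempty` is contradictory.
    have hp5 : p ≤ 5 := by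
      by_contra! h
      obtain rfl : p = 6 := by omega
      obtain ⟨x', hx'⟩ := OctSlice.exists_mem_of_isPreconnected_completion_six hDrefl
        hconn.isPreconnected ⟨_, hz⟩
      exact h0 x' hx'
    exact Set.ssubset_iff_exists.2 ⟨hsub, _,
      OctSlice.halfSliceIndicator_mem_GSM hp hDopen hDrefl h0' _,
      OctSlice.halfSliceIndicator_notMem_GSR hp5 hDrefl hr0 hz⟩
  · rw [← hx, ← OctSlice.slicePt_zero (EuclideanSpace.single 7 (1 : ℝ)),
      OctSlice.slicePt_mem_completion_iff hp hDrefl h7] at hy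
    exact (OctSlice.GSM_subset_GSR hp hDopen hDrefl hconn.isPreconnected hy).antisymm hsub
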